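/- Let $\mathbf{T}^1=\mathbb{R}/\mathbb{Z}$ be the circle of unit length with its arc-length distance. The 1-NN tree $T_n$ is built from independent uniform points $x_1,\dots,x_n\in\mathbf{T}^1$ by connecting each $x_i$, $i\ge 2$, to the closest point among $x_1,\dots,x_{i-1}$ (ties, which have probability zero, are broken arbitrarily). The embedded unlabeled tree $T_n^\circ$ consists of the set of points $\{x_1,\dots,x_n\}$ and the set of edges, without the times of arrival. An embedded root-finding procedure maps $T_n^\circ$ (for a given error parameter $\varepsilon$) to a finite set $H(\varepsilon,n)$ of vertices; it is meant to contain the root $x_1$. There are constants $c_1,c_2>0$ and a threshold $\varepsilon_0\in(0,1)$ such that the following holds for all $0<\varepsilon<\varepsilon_0$. (1) There is an algorithm (one program, with arithmetic operations and comparisons on real numbers at unit cost, which takes as input $\varepsilon$ and the positions and edges of $T_n^\circ$ listed in any order) that, for every $n\ge 1$, runs in time $O(n^2+\log^2(1/\varepsilon))$, with an absolute implied constant, and returns a set $H(\varepsilon,n)$ of vertices of $T_n^\circ$ with $$|H(\varepsilon,n)|\log|H(\varepsilon,n)|\le c_1\log(1/\varepsilon)\qquad\text{and}\qquad \mathbf{P}\{x_1\in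 H(\varepsilon,n)\}\ge 1-\varepsilon$$ (with the convention $0\log 0=0$). (2) Conversely, no procedure, whatever its running time and even if it is randomized independently of the tree, succeeds with a smaller set: for every $n\ge1$ with $n\log n\ge c_2\log(1/\varepsilon)$, if always $|H(\varepsilon,n)|\log|H(\varepsilon,n)|<c_2\log(1/\varepsilon)$, then $\mathbf{P}\{x_1\in H(\varepsilon,n)\}<1-\varepsilon$. Moreover, if $|H(\varepsilon,n)|\log|H(\varepsilon,n)|<c_2\log(1/\varepsilon)$ always holds for all $n$, then $\liminf_{n\to\infty}\mathbf{P}\{x_1\in H(\varepsilon,n)\}<1-\varepsilon$. (3) Consequently, if $K^*(\varepsilon)$ denotes the least $K$ for which some procedure satisfies $|H(\varepsilon,n)|\le K$ for all $n$ and $\liminf_{n\to\infty}\mathbf{P}\{x_1\in H(\varepsilon,n)\}\ge 1-\varepsilon$, then $K^*(\varepsilon)=\Theta\big(\log(1/\varepsilon)/\log\log(1/\varepsilon)\big)$ as $\varepsilon\to0^+$. -/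

import Mathlib

open Set Filter Topology MeasureTheory Asymptotics
open scoped ENNReal

noncomputable section

namespace NNTree

/-! ### The random nearest neighbour tree on the circle of unit length

`UnitAddCircle` is `ℝ / ℤ` with its quotient metric
`dist x y = min (|x - y|) (1 - |x - y|)` and its Haar probability measure `volume`.
The vertices are indexed by time of arrival in `Fin n`; the root is the vertex `0`. -/

/-- `j` is a closest vertex to `i` among the vertices that arrived before `i`. -/
def IsNearest {n : ℕ} (x : Fin n → UnitAddCircle) (i j : Fin n) : Prop :=
  j < i ∧ ∀ l, l < i → dist (x i) (x j) ≤ dist (x i) (x l)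

/-- The positions `x` and the parent map `p` form a valid nearest neighbour tree: every vertex
other than the root is connected to a closest earlier vertex (with any way to break ties). -/
def IsNNTree {n : ℕ} (x : Fin n → UnitAddCircle) (p : Fin n → Fin n) : Prop :=
  ∀ i : Fin n, 0 < i.val → IsNearest x i (p i)

open Classical in
/-- The closest earlier vertex; a tie, which has probability zero, goes to the earliest vertex.
(The root, which has no earlier vertex, gets the dummy value `i`.) -/
def nnParent {n : ℕ} (x : Fin n → UnitAddCircle) (i : Fin n) : Fin n :=
  if h : (Finset.univ.filter (fun j => IsNearest x i j)).Nonempty then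
    (Finset.univ.filter (fun j => IsNearest x i j)).min' h
  else i

/-- An embedded graph without labels: a finite set of points of the circle and a finite set of
unordered pairs of points. -/
@[ext]
structure EmbTree where
  verts : Finset UnitAddCircle
  edges : Finset (Sym2 UnitAddCircle)

open Classical in
/-- The embedded unlabeled tree of a tree with positions `x` and parent map `p`:
times of arrival are forgotten. -/
def embTree {n : ℕ} (x : Fin n → UnitAddCircle) (p : Fin n → Fin n) : EmbTree where
  verts := Finset.univ.image x
  edges := (Finset.univ.filter (fun i : Fin n => 0 < i.val)).image (fun i => s(x i, x (p i)))

/-- The embedded unlabeled nearest neighbour tree of the positions `x`. -/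
def nnTree {n : ℕ} (x : Fin n → UnitAddCircle) : EmbTree := embTree x (nnParent x)

theorem isNNTree_nnParent {n : ℕ} (x : Fin n → UnitAddCircle) : IsNNTree x (nnParent x) := by
  classical
  intro i hi
  have h : (Finset.univ.filter (fun j => IsNearest x i j)).Nonempty := by
    have h0 : (Finset.univ.filter (fun j : Fin n => j < i)).Nonempty :=
      ⟨⟨0, lt_of_le_of_lt (Nat.zero_le _) i.isLt⟩,
        Finset.mem_filter.2 ⟨Finset.mem_univ _, hi⟩⟩
    obtain ⟨j, hj, hmin⟩ := Finset.exists_min_image _ (fun j => dist (x i) (x j)) h0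
    refine ⟨j, ?_⟩
    simp only [Finset.mem_filter, Finset.mem_univ, true_and] at hj hmin ⊢
    exact ⟨hj, hmin⟩
  have hm := Finset.min'_mem _ h
  rw [Finset.mem_filter] at hm
  unfold nnParent
  rw [dif_pos h]
  exact hm.2

/-- An embedded root finding procedure, for a fixed value of the error parameter and for trees of
every size: it sees the embedded unlabeled tree and returns a finite set of points. No
computability and no measurability is asked for. -/
abbrev Procedure := EmbTree → Finset UnitAddCircle

/-- The probability that `H` returns the root of the nearest neighbour tree of `n` independent
uniform points: one minus the (outer) probability that it misses the root. When the event is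
measurable this is the probability of the event that `H` returns the root; in general it is the
inner probability of that event. -/
def rootProb (H : Procedure) (n : ℕ) [NeZero n] : ℝ≥0∞ :=
  1 - volume {x : Fin n → UnitAddCircle | x 0 ∉ H (nnTree x)}

/-- The procedure `H` is root finding with error parameter `ε`: in the limit of large trees,
the root is returned with probability at least `1 - ε`. -/
def IsRootFinding (ε : ℝ) (H : Procedure) : Prop :=
  1 - ENNReal.ofReal ε ≤ liminf (fun n : ℕ => rootProb H (n + 1)) atTop

/-- The least size of a confidence set that is valid for the error parameter `ε`. -/
def optimalSize (ε : ℝ) : ℕ :=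
  sInf {K : ℕ | ∃ H : Procedure, (∀ T, (H T).card ≤ K) ∧ IsRootFinding ε H}

/-! ### A real random access machine with unit cost

A program manipulates finitely many arrays of natural numbers and finitely many arrays of real
numbers; array entries can be addressed indirectly. One unit of time is charged for every
arithmetic operation, comparison, memory access, constant and command. On natural numbers there
are addition and (truncated) subtraction, on real numbers the four field operations and the
inclusion of the naturals; there is no rounding, no transcendental function and there are no
constants besides the natural numbers. -/

/-- The memory: `nats a i` is entry `i` of the array `a` of natural numbers, `reals a i` is
entry `i` of the array `a` of real numbers. -/
@[ext]
structure State where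
  nats : ℕ → ℕ → ℕ
  reals : ℕ → ℕ → ℝ

/-- Expressions for natural numbers. -/
inductive NExpr where
  | const (c : ℕ)
  | read (a : ℕ) (i : NExpr)
  | add (e f : NExpr)
  | sub (e f : NExpr)

def NExpr.eval (s : State) : NExpr → ℕ
  | .const c => c
  | .read a i => s.nats a (i.eval s)
  | .add e f => e.eval s + f.eval s
  | .sub e f => e.eval s - f.eval s

def NExpr.cost : NExpr → ℕ
  | .const _ => 1
  | .read _ i => i.cost + 1
  | .add e f => e.cost + f.cost + 1
  | .sub e f => e.cost + f.cost + 1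

/-- Expressions for real numbers. -/
inductive RExpr where
  | ofNat (e : NExpr)
  | read (a : ℕ) (i : NExpr)
  | add (e f : RExpr)
  | sub (e f : RExpr)
  | mul (e f : RExpr)
  | div (e f : RExpr)

def RExpr.eval (s : State) : RExpr → ℝ
  | .ofNat e => (e.eval s : ℝ)
  | .read a i => s.reals a (i.eval s)
  | .add e f => e.eval s + f.eval s
  | .sub e f => e.eval s - f.eval s
  | .mul e f => e.eval s * f.eval s
  | .div e f => e.eval s / f.eval s

def RExpr.cost : RExpr → ℕ
  | .ofNat e => e.cost + 1
  | .read _ i => i.cost + 1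
  | .add e f => e.cost + f.cost + 1
  | .sub e f => e.cost + f.cost + 1
  | .mul e f => e.cost + f.cost + 1
  | .div e f => e.cost + f.cost + 1

/-- Tests. -/
inductive Test where
  | nle (e f : NExpr)
  | rle (e f : RExpr)
  | not (b : Test)
  | and (b c : Test)

def Test.holds (s : State) : Test → Prop
  | .nle e f => e.eval s ≤ f.eval s
  | .rle e f => e.eval s ≤ f.eval s
  | .not b => ¬ b.holds s
  | .and b c => b.holds s ∧ c.holds s

def Test.cost : Test → ℕ
  | .nle e f => e.cost + f.cost + 1
  | .rle e f => e.cost + f.cost + 1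
  | .not b => b.cost + 1
  | .and b c => b.cost + c.cost + 1

/-- Programs. -/
inductive Prog where
  | skip
  | setNat (a : ℕ) (i e : NExpr)
  | setReal (a : ℕ) (i : NExpr) (e : RExpr)
  | seq (P Q : Prog)
  | ite (b : Test) (P Q : Prog)
  | while (b : Test) (P : Prog)

def State.setNat (s : State) (a i v : ℕ) : State :=
  { s with nats := Function.update s.nats a (Function.update (s.nats a) i v) }

def State.setReal (s : State) (a i : ℕ) (v : ℝ) : State :=
  { s with reals := Function.update s.reals a (Function.update (s.reals a) i v) }

/-- `Exec P s s' t`: started in the state `s`, the program `P` halts in the state `s'` after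
exactly `t` units of time. -/
inductive Exec : Prog → State → State → ℕ → Prop where
  | skip (s : State) : Exec .skip s s 1
  | setNat (s : State) (a : ℕ) (i e : NExpr) :
      Exec (.setNat a i e) s (s.setNat a (i.eval s) (e.eval s)) (i.cost + e.cost + 1)
  | setReal (s : State) (a : ℕ) (i : NExpr) (e : RExpr) :
      Exec (.setReal a i e) s (s.setReal a (i.eval s) (e.eval s)) (i.cost + e.cost + 1)
  | seq {P Q : Prog} {s s' s'' : State} {t t' : ℕ} :
      Exec P s s' t → Exec Q s' s'' t' → Exec (.seq P Q) s s'' (t + t')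
  | iteTrue {b : Test} {P Q : Prog} {s s' : State} {t : ℕ} :
      b.holds s → Exec P s s' t → Exec (.ite b P Q) s s' (b.cost + 1 + t)
  | iteFalse {b : Test} {P Q : Prog} {s s' : State} {t : ℕ} :
      ¬ b.holds s → Exec Q s s' t → Exec (.ite b P Q) s s' (b.cost + 1 + t)
  | whileTrue {b : Test} {P : Prog} {s s' s'' : State} {t t' : ℕ} :
      b.holds s → Exec P s s' t → Exec (.while b P) s' s'' t' →
        Exec (.while b P) s s'' (b.cost + 1 + t + t')
  | whileFalse {b : Test} {P : Prog} {s : State} :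
      ¬ b.holds s → Exec (.while b P) s s (b.cost + 1)

/-! ### Input and output of the machine -/

open Classical in
/-- `v`, `e` present the embedded tree `T` with `n` vertices: `v` lists the vertices in some
order without repetition, and `e` lists the `n - 1` edges, as pairs of indices, in some order and
with some orientation. -/
def IsPresentation {n : ℕ} (T : EmbTree) (v : Fin n → UnitAddCircle)
    (e : Fin (n - 1) → Fin n × Fin n) : Prop :=
  Function.Injective v ∧ Finset.univ.image v = T.verts ∧
    Function.Injective (fun k => s(v (e k).1, v (e k).2)) ∧
    Finset.univ.image (fun k => s(v (e k).1, v (e k).2)) = T.edges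

/-- The initial memory: `n` in entry `0` of the array `0` of naturals, the first and second
endpoints of the edges in the arrays `1` and `2` of naturals, the error parameter in entry `0` of
the array `0` of reals, the coordinates in `[0, 1)` of the vertices in the array `1` of reals.
All else is zero. -/
def initState {n : ℕ} (ε : ℝ) (v : Fin n → UnitAddCircle)
    (e : Fin (n - 1) → Fin n × Fin n) : State where
  nats a i :=
    match a with
    | 0 => if i = 0 then n else 0
    | 1 => if h : i < n - 1 then ((e ⟨i, h⟩).1 : ℕ) else 0
    | 2 => if h : i < n - 1 then ((e ⟨i, h⟩).2 : ℕ) else 0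
    | _ => 0
  reals a i :=
    match a with
    | 0 => if i = 0 then ε else 0
    | 1 => if h : i < n then (AddCircle.equivIco (1 : ℝ) 0 (v ⟨i, h⟩) : ℝ) else 0
    | _ => 0

/-- On the error parameter `ε` and on every presentation of the embedded tree `T`, the program
`P` halts within time `B` and returns the set `S` of vertices of `T`: entry `i` of the array `3`
of naturals is then nonzero exactly when the vertex `i` is in `S`. -/
def ReturnsWithin (P : Prog) (ε : ℝ) (T : EmbTree) (S : Finset UnitAddCircle) (B : ℝ) : Prop :=
  S ⊆ T.verts ∧
  ∀ (n : ℕ) (v : Fin n → UnitAddCircle) (e : Fin (n - 1) → Fin n × Fin n),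
    IsPresentation T v e →
      ∃ (s : State) (t : ℕ), Exec P (initState ε v e) s t ∧ (t : ℝ) ≤ B ∧
        ∀ i : Fin n, s.nats 3 (i : ℕ) ≠ 0 ↔ v i ∈ S

end NNTree

end

/-! Upper bound. Call a vertex covered if some edge is longer than its distance to either endpoint.
The root is never covered: a vertex joins a nearest earlier vertex, so its edge is at most as long
as its distance to the root. Around the root, follow the arc spanned by the arrivals and the gap
that it leaves. A vertex that arrives in the gap joins the nearer end of the arc, its edge covers
everything strictly in between, and the larger piece of the gap survives. So after `m` such arrivals
the arc holds at most `m + 1` uncovered vertices (`GapInv`). A uniform point splits the gap in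
proportions `U` and `1 - U`, and the `K`-th moment of the larger one is at most `2 / (K + 1)`. Hence
`((K + 1) / 2) ^ m * gap ^ K` is a supermartingale, and by Markov's inequality the gap exceeds `1 /
4` after `K` arrivals in it with probability at most `8 ^ K / K!` (`volume_gapBad_le`).

If there are `K` such arrivals and the gap is at most `1 / 4`, the root has at most `K + 1`
uncovered vertices within a quarter turn on one side. Only `O(K)` vertices in all share this
property: few on the arc are uncovered, and in the short gap only the extreme ones qualify
(`card_sparseHull_le`). With fewer than `K` such arrivals there are at most `K` uncovered vertices.
The test does not refer to the root and takes `O(n ^ 2)` comparisons. The least `K` with `8 ^ K / K!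
≤ ε` is found by running through these terms, and satisfies `K log K = O(log (1 / ε))`.

Lower bound. With probability `(1 / (16 K)) ^ K` the first `K` vertices land in order in `K`
separated slots and form a path. Reversing the first `k + 1` arrivals preserves both the law and the
embedded tree (`nnTree_revInit`), but makes the `k`-th path vertex the root. A set of fewer than `K`
vertices misses one of them, so the root is missed with probability at least `(1 / (16 K)) ^ K / K`,
which exceeds `ε` at the critical size. This bound is the same for all procedures, hence survives
randomization. Solving `K log K ≍ log (1 / ε)` for `K` gives the optimal size. -/

namespace NNTree

/-! ### Offsets on the circle -/

/-- The length of the counterclockwise arc from `a` to `b`. -/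
noncomputable def offset (a b : UnitAddCircle) : ℝ := AddCircle.equivIco (1 : ℝ) 0 (b - a)

theorem offset_nonneg (a b : UnitAddCircle) : 0 ≤ offset a b :=
  (AddCircle.equivIco (1 : ℝ) 0 (b - a)).2.1

theorem offset_lt_one (a b : UnitAddCircle) : offset a b < 1 :=
  (AddCircle.equivIco (1 : ℝ) 0 (b - a)).2.2.trans_eq (zero_add 1)

theorem coe_offset (a b : UnitAddCircle) : (offset a b : UnitAddCircle) = b - a :=
  AddCircle.coe_equivIco

theorem offset_eq {a b : UnitAddCircle} {t : ℝ} (h0 : 0 ≤ t) (h1 : t < 1)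
    (h : (t : UnitAddCircle) = b - a) : offset a b = t := by
  unfold offset
  rw [← h]
  exact AddCircle.equivIco_coe_of_mem (by simpa using ⟨h0, h1⟩)

theorem offset_self (a : UnitAddCircle) : offset a a = 0 :=
  offset_eq le_rfl one_pos (by simp)

theorem offset_injective (a : UnitAddCircle) : Function.Injective (offset a) := by
  intro b c h
  have := congrArg (fun t : ℝ => (t : UnitAddCircle)) h
  simpa [coe_offset] using this

theorem offset_of_le {a b c : UnitAddCircle} (h : offset a b ≤ offset a c) :
    offset b c = offset a c - offset a b := by
  refine offset_eq (by linarith) (by linarith [offset_nonneg a b, offset_lt_one a c]) ?_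
  rw [AddCircle.coe_sub, coe_offset, coe_offset]; abel

theorem offset_of_lt {a b c : UnitAddCircle} (h : offset a c < offset a b) :
    offset b c = offset a c - offset a b + 1 := by
  refine offset_eq (by linarith [offset_nonneg a c, offset_lt_one a b]) (by linarith) ?_
  rw [AddCircle.coe_add, AddCircle.coe_sub, coe_offset, coe_offset, AddCircle.coe_period]; abel

theorem dist_eq_min_offset (a b : UnitAddCircle) :
    dist a b = min (offset a b) (1 - offset a b) := by
  rw [dist_comm, dist_eq_norm, ← coe_offset a b, UnitAddCircle.norm_eq, abs_sub_round_eq_min,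
    Int.fract_eq_self.2 ⟨offset_nonneg a b, offset_lt_one a b⟩]

theorem dist_eq_min_abs (a b c : UnitAddCircle) :
    dist b c = min |offset a b - offset a c| (1 - |offset a b - offset a c|) := by
  rcases le_or_gt (offset a b) (offset a c) with h | h
  · rw [dist_eq_min_offset, offset_of_le h, abs_of_nonpos (by linarith)]
    ring_nf
  · rw [dist_comm, dist_eq_min_offset, offset_of_le h.le, abs_of_pos (by linarith)]

theorem dist_le_abs_offset (a b c : UnitAddCircle) : dist b c ≤ |offset a b - offset a c| := by
  rw [dist_eq_min_abs a]; exact min_le_left _ _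

theorem measurable_offset (a : UnitAddCircle) : Measurable (offset a) := by
  have h : Measurable (fun b => (AddCircle.measurableEquivIco (1 : ℝ) 0 b : ℝ)) :=
    measurable_subtype_coe.comp (AddCircle.measurableEquivIco (1 : ℝ) 0).measurable
  exact h.comp (measurable_id.sub_const a)

theorem measurable_offset_pair :
    Measurable (fun q : UnitAddCircle × UnitAddCircle => offset q.1 q.2) := by
  have h : Measurable (fun b => (AddCircle.measurableEquivIco (1 : ℝ) 0 b : ℝ)) :=
    measurable_subtype_coe.comp (AddCircle.measurableEquivIco (1 : ℝ) 0).measurable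
  exact h.comp (measurable_snd.sub measurable_fst)

/-- By rotation invariance, the offset of a uniform point from any fixed point is uniform on `(0,
1)`. One-step computations thus become integrals over an interval. -/
theorem lintegral_offset (a : UnitAddCircle) (f : ℝ → ℝ≥0∞) :
    ∫⁻ y, f (offset a y) = ∫⁻ t in Ioo (0 : ℝ) 1, f t := by
  have h1 : ∫⁻ y, f (offset a y) = ∫⁻ y, f (offset 0 y) := by
    have h := lintegral_sub_right_eq_self (μ := (volume : Measure UnitAddCircle))
      (fun y => f (offset 0 y)) a
    rw [← h]
    simp [offset]
  rw [h1, ← UnitAddCircle.lintegral_preimage 0, ← setLIntegral_congr (Ioo_ae_eq_Ioc)]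
  simp only [zero_add]
  refine setLIntegral_congr_fun measurableSet_Ioo fun t ht => ?_
  rw [offset_eq (t := t) ht.1.le ht.2 (by simp)]

/-! ### The candidate roots -/

/-- `r` lies strictly within the length of an edge from both of its endpoints. -/
def Covered (T : EmbTree) (r : UnitAddCircle) : Prop :=
  ∃ u v : UnitAddCircle, s(u, v) ∈ T.edges ∧ dist r u < dist u v ∧ dist r v < dist u v

open Classical in
/-- The vertices that are not covered by an edge. -/
noncomputable def hull (T : EmbTree) : Finset UnitAddCircle :=
  T.verts.filter fun r => ¬ Covered T r

open Classical in
/-- The uncovered vertices within a quarter turn counterclockwise from `r`. -/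
noncomputable def hullAfter (T : EmbTree) (r : UnitAddCircle) : Finset UnitAddCircle :=
  (hull T).filter fun s => 0 < offset r s ∧ offset r s ≤ 1 / 4

open Classical in
/-- The uncovered vertices within a quarter turn clockwise from `r`. -/
noncomputable def hullBefore (T : EmbTree) (r : UnitAddCircle) : Finset UnitAddCircle :=
  (hull T).filter fun s => 3 / 4 ≤ offset r s

open Classical in
/-- The uncovered vertices with at most `K + 1` uncovered vertices within a quarter turn in one
of the two directions. -/
noncomputable def sparseHull (K : ℕ) (T : EmbTree) : Finset UnitAddCircle :=
  (hull T).filter fun r => (hullAfter T r).card ≤ K + 1 ∨ (hullBefore T r).card ≤ K + 1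

/-- The confidence set of parameter `K`. -/
noncomputable def confSet (K : ℕ) : Procedure := fun T =>
  -- `3 * K + 5 = (K + 1) + 2 * (K + 2)` allows for the uncovered vertices of the arc and for those
  -- of the gap that are among its `K + 2` extreme ones on either side. The cut-off makes the size
  -- bound hold for every tree.
  if (sparseHull K T).card ≤ 3 * K + 5 then sparseHull K T else ∅

theorem confSet_subset (K : ℕ) (T : EmbTree) : confSet K T ⊆ T.verts := by
  classical
  unfold confSet
  split_ifs
  · exact (Finset.filter_subset _ _).trans (Finset.filter_subset _ _)
  · exact Finset.empty_subset _

theorem card_confSet_le (K : ℕ) (T : EmbTree) : (confSet K T).card ≤ 3 * K + 5 := by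
  unfold confSet
  split_ifs with h
  · exact h
  · simp

open Classical in
-- The element of the subset with the least value sees all the others above it, so there are at most
-- `k` others.
theorem card_filter_few_above {ι : Type*} (S : Finset ι) (f : ι → ℝ) (hf : Set.InjOn f S) (k : ℕ) :
    (S.filter fun r => (S.filter fun s => f r < f s).card ≤ k).card ≤ k + 1 := by
  set A := S.filter fun r => (S.filter fun s => f r < f s).card ≤ k with hA
  rcases A.eq_empty_or_nonempty with h | h
  · simp [h]
  obtain ⟨r, hr, hmin⟩ := Finset.exists_min_image A f h
  have hr' := (Finset.mem_filter.1 hr)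
  have hsub : A ⊆ insert r (S.filter fun s => f r < f s) := by
    intro s hs
    by_cases hsr : s = r
    · simp [hsr]
    have hsS := (Finset.mem_filter.1 hs).1
    refine Finset.mem_insert_of_mem (Finset.mem_filter.2 ⟨hsS, ?_⟩)
    exact (hmin s hs).lt_of_ne fun h => hsr (hf hsS hr'.1 h.symm)
  exact (Finset.card_le_card hsub).trans ((Finset.card_insert_le _ _).trans (by omega))

theorem mem_hull {T : EmbTree} {r : UnitAddCircle} : r ∈ hull T ↔ r ∈ T.verts ∧ ¬ Covered T r := by
  classical
  exact Finset.mem_filter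

/-- If all but `k` of the uncovered vertices lie in an arc of length at most `1 / 4`, then the set
`sparseHull` is small. -/
theorem card_sparseHull_le (K k : ℕ) (T : EmbTree) (a : UnitAddCircle) (R L : ℝ)
    (hG : 1 - L - R ≤ 1 / 4) (S : Finset UnitAddCircle) (hS : S.card ≤ k)
    (hcov : ∀ r ∈ hull T, offset a r ≤ R ∨ 1 - L ≤ offset a r → r ∈ S) :
    (sparseHull K T).card ≤ k + 2 * (K + 2) := by
  classical
  -- Two points of the gap are less than a quarter turn apart, so in `B` the quarter-turn
  -- neighbourhoods are just the initial and final segments for the order of offsets. A sparse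
  -- vertex of `B` is therefore among its first or last `K + 2`.
  set B := (hull T).filter fun r => R < offset a r ∧ offset a r < 1 - L with hB
  have hBG : ∀ r ∈ B, ∀ s ∈ B, offset a r < offset a s →
      0 < offset r s ∧ offset r s ≤ 1 / 4 := by
    intro r hr s hs h
    have h1 := (Finset.mem_filter.1 hr).2
    have h2 := (Finset.mem_filter.1 hs).2
    rw [offset_of_le h.le]
    constructor <;> linarith
  have hBG' : ∀ r ∈ B, ∀ s ∈ B, offset a s < offset a r → 3 / 4 ≤ offset r s := by
    intro r hr s hs h
    have h1 := (Finset.mem_filter.1 hr).2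
    have h2 := (Finset.mem_filter.1 hs).2
    rw [offset_of_lt h]
    linarith
  have hinj := (offset_injective a).injOn (s := (B : Set UnitAddCircle))
  have h1 := card_filter_few_above B (offset a) hinj (K + 1)
  have h2 := card_filter_few_above B (fun r => - offset a r)
    (fun x hx y hy h => hinj hx hy (neg_injective h)) (K + 1)
  have hsub : sparseHull K T ⊆ S ∪
      ((B.filter fun r => (B.filter fun s => offset a r < offset a s).card ≤ K + 1) ∪
       (B.filter fun r => (B.filter fun s => - offset a r < - offset a s).card ≤ K + 1)) := by
    intro r hr
    obtain ⟨hr1, hr2⟩ := Finset.mem_filter.1 hr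
    by_cases hc : offset a r ≤ R ∨ 1 - L ≤ offset a r
    · exact Finset.mem_union_left _ (hcov r hr1 hc)
    push Not at hc
    have hrB : r ∈ B := Finset.mem_filter.2 ⟨hr1, hc⟩
    refine Finset.mem_union_right _ (Finset.mem_union.2 ?_)
    rcases hr2 with h | h
    · left
      refine Finset.mem_filter.2 ⟨hrB, le_trans (Finset.card_le_card ?_) h⟩
      intro s hs
      obtain ⟨hs1, hs2⟩ := Finset.mem_filter.1 hs
      exact Finset.mem_filter.2 ⟨(Finset.mem_filter.1 hs1).1, hBG r hrB s hs1 hs2⟩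
    · right
      refine Finset.mem_filter.2 ⟨hrB, le_trans (Finset.card_le_card ?_) h⟩
      intro s hs
      obtain ⟨hs1, hs2⟩ := Finset.mem_filter.1 hs
      exact Finset.mem_filter.2 ⟨(Finset.mem_filter.1 hs1).1, hBG' r hrB s hs1 (by linarith)⟩
  refine (Finset.card_le_card hsub).trans ((Finset.card_union_le _ _).trans ?_)
  have := Finset.card_union_le
    (B.filter fun r => (B.filter fun s => offset a r < offset a s).card ≤ K + 1)
    (B.filter fun r => (B.filter fun s => - offset a r < - offset a s).card ≤ K + 1)
  omega

/-- If the uncovered vertices in an arc around the root `a` of length at least `3 / 4` belong to a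
set of `K + 1` vertices, then the confidence set contains the root. -/
theorem mem_confSet_of_arc (K : ℕ) (T : EmbTree) (a : UnitAddCircle) (ha : a ∈ hull T) (R L : ℝ)
    (hG : 1 - L - R ≤ 1 / 4) (S : Finset UnitAddCircle) (hS : S.card ≤ K + 1)
    (hcov : ∀ r ∈ hull T, offset a r ≤ R ∨ 1 - L ≤ offset a r → r ∈ S) :
    a ∈ confSet K T := by
  classical
  have hcard : (sparseHull K T).card ≤ 3 * K + 5 :=
    (card_sparseHull_le K (K + 1) T a R L hG S hS hcov).trans (by omega)
  unfold confSet
  rw [if_pos hcard]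
  refine Finset.mem_filter.2 ⟨ha, ?_⟩
  -- Since `L + R ≥ 3 / 4`, the arc contains a full quarter turn on at least one side of the root.
  rcases le_or_gt (1 / 4) R with hR | hR
  · left
    refine le_trans (Finset.card_le_card fun s hs => ?_) hS
    obtain ⟨hs1, hs2⟩ := Finset.mem_filter.1 hs
    exact hcov s hs1 (Or.inl (by linarith))
  · right
    refine le_trans (Finset.card_le_card fun s hs => ?_) hS
    obtain ⟨hs1, hs2⟩ := Finset.mem_filter.1 hs
    exact hcov s hs1 (Or.inr (by linarith))

theorem mem_confSet_of_card (K : ℕ) (T : EmbTree) (a : UnitAddCircle) (ha : a ∈ hull T)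
    (h : (hull T).card ≤ K + 1) : a ∈ confSet K T := by
  classical
  have hcard : (sparseHull K T).card ≤ 3 * K + 5 :=
    (Finset.card_filter_le _ _).trans (by omega)
  unfold confSet
  rw [if_pos hcard]
  exact Finset.mem_filter.2 ⟨ha, Or.inl ((Finset.card_filter_le _ _).trans h)⟩

/-- The root is not covered. -/
theorem root_mem_hull {n : ℕ} [NeZero n] (x : Fin n → UnitAddCircle) :
    x 0 ∈ hull (nnTree x) := by
  classical
  refine mem_hull.2 ⟨Finset.mem_image_of_mem _ (Finset.mem_univ _), ?_⟩
  rintro ⟨u, v, he, h1, h2⟩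
  obtain ⟨i, hi, hs⟩ := Finset.mem_image.1 he
  have hi0 : 0 < i.val := (Finset.mem_filter.1 hi).2
  have hn := (isNNTree_nnParent x i hi0).2 0 (Fin.lt_def.2 (by simpa using hi0))
  rcases Sym2.eq_iff.1 hs with ⟨rfl, rfl⟩ | ⟨rfl, rfl⟩
  · rw [dist_comm] at h1; linarith
  · rw [dist_comm (x (nnParent x i))] at h2
    rw [dist_comm] at h2; linarith

/-! ### The outer gap process

The state `(m, L, R)` says that the vertices so far lie on the arc of offsets `[-L, R]` around the
root, the rest of the circle being a gap in which `m` vertices have arrived. The process stops when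
`m = K`; a tie between the endpoints of the gap sends it to the stopped state `(K, 0, 0)`. -/

open Classical in
noncomputable def gapStep (K : ℕ) (s : ℕ × ℝ × ℝ) (t : ℝ) : ℕ × ℝ × ℝ :=
  if s.1 < K ∧ s.2.2 < t ∧ t < 1 - s.2.1 then
    if t - s.2.2 < 1 - s.2.1 - t then (s.1 + 1, s.2.1, t)
    else if 1 - s.2.1 - t < t - s.2.2 then (s.1 + 1, 1 - t, s.2.2)
    -- This state has gap length `1`, hence is bad: a tie needs no geometric analysis and costs
    -- nothing in probability.
    else (K, 0, 0)
  else s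

noncomputable def gapState (K : ℕ) {n : ℕ} [NeZero n] (x : Fin n → UnitAddCircle) :
    ℕ → ℕ × ℝ × ℝ
  | 0 => (0, 0, 0)
  | i + 1 => if h : i < n then gapStep K (gapState K x i) (offset (x 0) (x ⟨i, h⟩))
      else gapState K x i

/-- The bad event: the process has stopped with a gap larger than `1 / 4`. -/
def GapBad (K : ℕ) (s : ℕ × ℝ × ℝ) : Prop := s.1 = K ∧ 1 / 4 < 1 - s.2.1 - s.2.2

theorem gapStep_of_eq {K : ℕ} {s : ℕ × ℝ × ℝ} (h : s.1 = K) (t : ℝ) : gapStep K s t = s := by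
  unfold gapStep
  rw [if_neg (by omega)]

theorem gapStep_cases (K : ℕ) (s : ℕ × ℝ × ℝ) (t : ℝ) :
    (gapStep K s t = s ∧ (s.1 < K → t ≤ s.2.2 ∨ 1 - s.2.1 ≤ t)) ∨
    (s.1 < K ∧ s.2.2 < t ∧ t < 1 - s.2.1 ∧
      ((t - s.2.2 < 1 - s.2.1 - t ∧ gapStep K s t = (s.1 + 1, s.2.1, t)) ∨
       (1 - s.2.1 - t < t - s.2.2 ∧ gapStep K s t = (s.1 + 1, 1 - t, s.2.2)) ∨
       (1 - s.2.1 - t = t - s.2.2 ∧ gapStep K s t = (K, 0, 0)))) := by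
  unfold gapStep
  split_ifs with h h1 h2
  · exact Or.inr ⟨h.1, h.2.1, h.2.2, Or.inl ⟨h1, rfl⟩⟩
  · exact Or.inr ⟨h.1, h.2.1, h.2.2, Or.inr (Or.inl ⟨h2, rfl⟩)⟩
  · exact Or.inr ⟨h.1, h.2.1, h.2.2, Or.inr (Or.inr ⟨by linarith, rfl⟩)⟩
  · refine Or.inl ⟨rfl, fun hK => ?_⟩
    by_contra! hc
    exact h ⟨hK, hc⟩

/-- The states with a gap of positive length. -/
def GapValid (K : ℕ) (s : ℕ × ℝ × ℝ) : Prop :=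
  s.1 ≤ K ∧ 0 ≤ s.2.1 ∧ 0 ≤ s.2.2 ∧ s.2.1 + s.2.2 < 1

theorem GapValid.step {K : ℕ} {s : ℕ × ℝ × ℝ} (h : GapValid K s) {t : ℝ} :
    GapValid K (gapStep K s t) := by
  obtain ⟨h1, h2, h3, h4⟩ := h
  rcases gapStep_cases K s t with ⟨h, -⟩ | ⟨a, b, c, ⟨d, h⟩ | ⟨d, h⟩ | ⟨d, h⟩⟩ <;> rw [h]
  · exact ⟨h1, h2, h3, h4⟩
  · exact ⟨a, h2, by dsimp only; linarith, by dsimp only; linarith⟩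
  · exact ⟨a, by dsimp only; linarith, h3, by dsimp only; linarith⟩
  · exact ⟨le_rfl, le_rfl, le_rfl, by dsimp only; linarith⟩

theorem gapValid_gapState (K : ℕ) {n : ℕ} [NeZero n] (x : Fin n → UnitAddCircle) (i : ℕ) :
    GapValid K (gapState K x i) := by
  induction i with
  | zero => exact ⟨Nat.zero_le _, le_rfl, le_rfl, by simp [gapState]⟩
  | succ i ih =>
    unfold gapState
    split_ifs
    · exact ih.step
    · exact ih

/-- Going right from `y`, the arc is first met at its left end, which is too far; going left it is
first met at `R`. So a vertex of the arc this close can only be the right end. -/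
theorem offset_eq_of_nearest_right {a y q : UnitAddCircle} {R L : ℝ} (hL : 0 ≤ L) (hR : 0 ≤ R)
    (h2 : offset a y - R < 1 - L - offset a y) (hq : offset a q ≤ R ∨ 1 - L ≤ offset a q)
    (hd : dist y q ≤ offset a y - R) : offset a q = R := by
  rw [dist_eq_min_abs a] at hd
  have := offset_nonneg a q
  have := offset_lt_one a q
  have := offset_lt_one a y
  rcases hq with h | h <;> rcases min_le_iff.1 hd with h' | h' <;>
    cases abs_cases (offset a y - offset a q) <;> linarith

theorem offset_eq_of_nearest_left {a y q : UnitAddCircle} {R L : ℝ} (hL : 0 ≤ L) (hR : 0 ≤ R)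
    (h1 : R < offset a y) (h2 : 1 - L - offset a y < offset a y - R)
    (hq : offset a q ≤ R ∨ 1 - L ≤ offset a q)
    (hd : dist y q ≤ 1 - L - offset a y) : offset a q = 1 - L ∨ (L = 0 ∧ offset a q = 0) := by
  rw [dist_eq_min_abs a] at hd
  have := offset_nonneg a q
  have := offset_lt_one a q
  have := offset_lt_one a y
  rcases hq with h | h
  · right
    rcases min_le_iff.1 hd with h' | h' <;>
      cases abs_cases (offset a y - offset a q) <;> constructor <;> linarith
  · left
    rcases min_le_iff.1 hd with h' | h' <;>
      cases abs_cases (offset a y - offset a q) <;> linarith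

/-- What is known of the tree on the positions `x` when the gap process after the first `i`
arrivals is in the state `s`. -/
structure GapInv (K : ℕ) {n : ℕ} [NeZero n] (x : Fin n → UnitAddCircle) (i : ℕ)
    (s : ℕ × ℝ × ℝ) : Prop where
  -- This refers to the final tree, and the arc stops growing with the process, so the clause
  -- persists after stopping. The other three do not: vertices keep arriving in the gap, and they
  -- are only required while `s.1 < K`.
  covered : ∃ S : Finset UnitAddCircle, S.card ≤ s.1 + 1 ∧
    ∀ r, offset (x 0) r ≤ s.2.2 ∨ 1 - s.2.1 ≤ offset (x 0) r → r ∈ S ∨ Covered (nnTree x) r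
  arc : s.1 < K → ∀ j : Fin n, j.val < i → offset (x 0) (x j) ≤ s.2.2 ∨ 1 - s.2.1 ≤ offset (x 0) (x j)
  right_end : s.1 < K → ∃ j : Fin n, j.val < i ∧ offset (x 0) (x j) = s.2.2
  -- While `L = 0` the left end is the root, whose offset is `0` and not `1`.
  left_end : s.1 < K → ∃ j : Fin n, j.val < i ∧
    (offset (x 0) (x j) = 1 - s.2.1 ∨ (s.2.1 = 0 ∧ offset (x 0) (x j) = 0))

theorem edge_mem_nnTree {n : ℕ} (x : Fin n → UnitAddCircle) (i : Fin n) (hi : 0 < i.val) :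
    s(x i, x (nnParent x i)) ∈ (nnTree x).edges := by
  classical
  exact Finset.mem_image.2 ⟨i, Finset.mem_filter.2 ⟨Finset.mem_univ _, hi⟩, rfl⟩

theorem gapInv_init (K : ℕ) {n : ℕ} [NeZero n] (x : Fin n → UnitAddCircle) :
    GapInv K x 1 (0, 0, 0) where
  covered := by
    refine ⟨{x 0}, by simp, fun r hr => Or.inl ?_⟩
    rcases hr with h | h
    · rw [Finset.mem_singleton]
      refine offset_injective (x 0) ?_
      rw [offset_self]
      exact le_antisymm h (offset_nonneg _ _)
    · exact absurd (offset_lt_one (x 0) r) (by simpa using h)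
  arc _ j hj := by
    have : j = 0 := Fin.ext (by simpa using hj)
    left; simp [this, offset_self]
  right_end _ := ⟨0, by simp, by simp [offset_self]⟩
  left_end _ := ⟨0, by simp, by simp [offset_self]⟩

/-- The new edge joins `x i` to the right end of the arc. A point strictly between them is nearer to
both than the length of the edge, hence covered, so `x i` is the only new candidate. -/
theorem GapInv.insert_right {K : ℕ} {n : ℕ} [NeZero n] {x : Fin n → UnitAddCircle} {i : Fin n}
    {s : ℕ × ℝ × ℝ} (h : GapInv K x i s) (hv : GapValid K s) (hi : 0 < i.val) (hK : s.1 < K)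
    (h1 : s.2.2 < offset (x 0) (x i))
    (h3 : offset (x 0) (x i) - s.2.2 < 1 - s.2.1 - offset (x 0) (x i)) :
    GapInv K x (i + 1) (s.1 + 1, s.2.1, offset (x 0) (x i)) := by
  classical
  obtain ⟨-, hL, hR, -⟩ := hv
  obtain ⟨j, hj, hjR⟩ := h.right_end hK
  have hp := isNNTree_nnParent x i hi
  set p := nnParent x i with hpdef
  have hd : dist (x i) (x p) ≤ offset (x 0) (x i) - s.2.2 := by
    refine (hp.2 j hj).trans ((dist_le_abs_offset (x 0) _ _).trans ?_)
    rw [hjR, abs_of_pos (by linarith)]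
  have hpR := offset_eq_of_nearest_right hL hR h3 (h.arc hK p hp.1) hd
  have hd' : dist (x i) (x p) = offset (x 0) (x i) - s.2.2 := by
    rw [dist_eq_min_abs (x 0), hpR, abs_of_pos (by linarith), min_eq_left (by linarith)]
  have he := edge_mem_nnTree x i hi
  refine ⟨?_, fun _ j' hj' => ?_, fun _ => ⟨i, by simp, rfl⟩, fun _ => ?_⟩
  · obtain ⟨S, hS, hcov⟩ := h.covered
    refine ⟨insert (x i) S, (Finset.card_insert_le _ _).trans (by simpa using hS), fun r hr => ?_⟩
    by_cases hc : offset (x 0) r ≤ s.2.2 ∨ 1 - s.2.1 ≤ offset (x 0) r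
    · exact (hcov r hc).imp_left (Finset.mem_insert_of_mem)
    push Not at hc
    rcases hr with hr | hr
    · rcases hr.eq_or_lt with hr | hr
      · left
        rw [offset_injective _ hr]; exact Finset.mem_insert_self _ _
      · right
        refine ⟨_, _, he, ?_, ?_⟩
        · rw [hd']
          refine (dist_le_abs_offset (x 0) _ _).trans_lt ?_
          rw [abs_of_neg (by simpa using hr)]; linarith
        · rw [hd']
          refine (dist_le_abs_offset (x 0) _ _).trans_lt ?_
          rw [← hpdef, hpR, abs_of_pos (by linarith)]
          simpa using hr
    · exact absurd hc.2 (not_lt.2 hr)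
  · rcases Nat.lt_succ_iff_lt_or_eq.1 hj' with hj' | hj'
    · exact (h.arc hK j' hj').imp_left fun h => h.trans h1.le
    · left
      rw [Fin.ext hj']
  · obtain ⟨j', hj', h'⟩ := h.left_end hK
    exact ⟨j', by omega, h'⟩

theorem GapInv.insert_left {K : ℕ} {n : ℕ} [NeZero n] {x : Fin n → UnitAddCircle} {i : Fin n}
    {s : ℕ × ℝ × ℝ} (h : GapInv K x i s) (hv : GapValid K s) (hi : 0 < i.val) (hK : s.1 < K)
    (h1 : s.2.2 < offset (x 0) (x i)) (h2 : offset (x 0) (x i) < 1 - s.2.1)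
    (h3 : 1 - s.2.1 - offset (x 0) (x i) < offset (x 0) (x i) - s.2.2) :
    GapInv K x (i + 1) (s.1 + 1, 1 - offset (x 0) (x i), s.2.2) := by
  classical
  obtain ⟨-, hL, hR, -⟩ := hv
  -- Treats both forms of the left end at once: offset `1 - L`, or the root when `L = 0`, where the
  -- distance is measured the other way round the circle.
  have hend : ∀ (q r : UnitAddCircle),
      (offset (x 0) q = 1 - s.2.1 ∨ (s.2.1 = 0 ∧ offset (x 0) q = 0)) →
      offset (x 0) r < 1 - s.2.1 → dist r q ≤ 1 - s.2.1 - offset (x 0) r := by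
    intro q r hq hr
    rw [dist_eq_min_abs (x 0)]
    rcases hq with hq | ⟨hq, hq'⟩
    · refine min_le_of_left_le ?_
      rw [hq, abs_of_neg (by linarith)]; linarith
    · refine min_le_of_right_le ?_
      rw [hq', hq, sub_zero, abs_of_nonneg (offset_nonneg _ _)]; linarith
  obtain ⟨j, hj, hjL⟩ := h.left_end hK
  have hp := isNNTree_nnParent x i hi
  set p := nnParent x i with hpdef
  have hd : dist (x i) (x p) ≤ 1 - s.2.1 - offset (x 0) (x i) :=
    (hp.2 j hj).trans (hend _ _ hjL h2)
  have hpL := offset_eq_of_nearest_left hL hR h1 h3 (h.arc hK p hp.1) hd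
  have hd' : dist (x i) (x p) = 1 - s.2.1 - offset (x 0) (x i) := by
    refine le_antisymm hd ?_
    rw [dist_eq_min_abs (x 0)]
    rcases hpL with hq | ⟨hq, hq'⟩
    · rw [hq, abs_of_neg (by linarith)]; exact le_min (by linarith) (by linarith)
    · rw [hq', hq, sub_zero, sub_zero, abs_of_nonneg (offset_nonneg _ _)]
      exact le_min (by linarith) (by linarith)
  have he := edge_mem_nnTree x i hi
  refine ⟨?_, fun _ j' hj' => ?_, fun _ => ?_, fun _ => ⟨i, by simp, by simp⟩⟩
  · obtain ⟨S, hS, hcov⟩ := h.covered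
    refine ⟨insert (x i) S, (Finset.card_insert_le _ _).trans (by simpa using hS), fun r hr => ?_⟩
    by_cases hc : offset (x 0) r ≤ s.2.2 ∨ 1 - s.2.1 ≤ offset (x 0) r
    · exact (hcov r hc).imp_left (Finset.mem_insert_of_mem)
    push Not at hc
    rcases hr with hr | hr
    · exact absurd hc.1 (not_lt.2 hr)
    · rw [sub_sub_cancel] at hr
      rcases hr.eq_or_lt with hr | hr
      · left
        rw [← offset_injective _ hr]; exact Finset.mem_insert_self _ _
      · right
        refine ⟨_, _, he, ?_, ?_⟩
        · rw [hd']
          refine (dist_le_abs_offset (x 0) _ _).trans_lt ?_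
          rw [abs_of_pos (by linarith)]; linarith
        · rw [hd']
          exact (hend _ _ hpL hc.2).trans_lt (by linarith)
  · rcases Nat.lt_succ_iff_lt_or_eq.1 hj' with hj' | hj'
    · refine (h.arc hK j' hj').imp_right fun h => ?_
      dsimp only; linarith
    · right
      rw [Fin.ext hj']; simp
  · obtain ⟨j', hj', h'⟩ := h.right_end hK
    exact ⟨j', by omega, h'⟩

theorem gapInv_or_bad (K : ℕ) {n : ℕ} [NeZero n] (x : Fin n → UnitAddCircle) (i : ℕ)
    (hi : i + 1 ≤ n) :
    GapBad K (gapState K x (i + 1)) ∨ GapInv K x (i + 1) (gapState K x (i + 1)) := by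
  induction i with
  | zero =>
    right
    -- The root has offset `0` from itself, which is outside the open gap, so the first step does
    -- nothing.
    have : gapState K x 1 = (0, 0, 0) := by
      unfold gapState
      rw [dif_pos (by omega : 0 < n)]
      rcases gapStep_cases K (gapState K x 0) (offset (x 0) (x ⟨0, by omega⟩)) with h | h
      · rw [h.1]; rfl
      · exfalso
        have h' := h.2.1
        have : (⟨0, by omega⟩ : Fin n) = 0 := Fin.ext (by simp)
        rw [this, offset_self] at h'
        simp [gapState] at h'
    rw [this]
    exact gapInv_init K x
  | succ i ih =>
    have ih := ih (by omega)
    have hv := gapValid_gapState K x (i + 1)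
    have hst : gapState K x (i + 1 + 1) =
        gapStep K (gapState K x (i + 1)) (offset (x 0) (x ⟨i + 1, by omega⟩)) := by
      rw [gapState, dif_pos]
    rw [hst]
    generalize hs : gapState K x (i + 1) = s at *
    rcases ih with ih | ih
    · left
      rwa [gapStep_of_eq ih.1]
    rcases gapStep_cases K s (offset (x 0) (x ⟨i + 1, by omega⟩)) with
      ⟨h, h'⟩ | ⟨a, b, c, ⟨d, h⟩ | ⟨d, h⟩ | ⟨d, h⟩⟩ <;> rw [h]
    · right
      refine ⟨ih.covered, fun hK j hj => ?_, fun hK => ?_, fun hK => ?_⟩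
      · rcases Nat.lt_succ_iff_lt_or_eq.1 hj with hj | hj
        · exact ih.arc hK j hj
        · have : j = ⟨i + 1, by omega⟩ := Fin.ext hj
          rw [this]; exact h' hK
      · obtain ⟨j, hj, h⟩ := ih.right_end hK
        exact ⟨j, by omega, h⟩
      · obtain ⟨j, hj, h⟩ := ih.left_end hK
        exact ⟨j, by omega, h⟩
    · exact Or.inr (GapInv.insert_right (i := ⟨i + 1, by omega⟩) ih hv (by simp) a b d)
    · exact Or.inr (GapInv.insert_left (i := ⟨i + 1, by omega⟩) ih hv (by simp) a b c d)
    · left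
      exact ⟨rfl, by norm_num⟩

/-- If the process is still running after all `n` arrivals, every vertex lies on the arc and the
whole hull is small. If it has stopped without being bad, the gap is at most `1 / 4` and the arc
criterion applies. -/
theorem root_mem_confSet (K : ℕ) {n : ℕ} [NeZero n] (x : Fin n → UnitAddCircle)
    (h : ¬ GapBad K (gapState K x n)) : x 0 ∈ confSet K (nnTree x) := by
  classical
  obtain ⟨k, rfl⟩ := Nat.exists_eq_succ_of_ne_zero (NeZero.ne n)
  have hinv := (gapInv_or_bad K x k le_rfl).resolve_left h
  have hv := gapValid_gapState K x (k + 1)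
  change ¬ GapBad K (gapState K x (k + 1)) at h
  generalize hs : gapState K x (k + 1) = s at *
  obtain ⟨S, hS, hcov⟩ := hinv.covered
  rcases hv.1.lt_or_eq with hlt | heq
  · refine mem_confSet_of_card K _ _ (root_mem_hull x) ?_
    refine (Finset.card_le_card fun r hr => ?_).trans (hS.trans (by omega))
    obtain ⟨hr1, hr2⟩ := mem_hull.1 hr
    obtain ⟨j, -, rfl⟩ := Finset.mem_image.1 hr1
    exact (hcov _ (hinv.arc hlt j j.isLt)).resolve_right hr2
  · have hG : 1 - s.2.1 - s.2.2 ≤ 1 / 4 := by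
      by_contra! hc
      exact h ⟨heq, hc⟩
    refine mem_confSet_of_arc K _ _ (root_mem_hull x) _ _ hG S (by omega) fun r hr hr' => ?_
    exact (hcov r hr').resolve_right (mem_hull.1 hr).2

/-! ### Measurability and tail bound for the gap process -/

theorem measurable_gapStep (K : ℕ) :
    Measurable (fun q : (ℕ × ℝ × ℝ) × ℝ => gapStep K q.1 q.2) := by
  have hm : Measurable (fun q : (ℕ × ℝ × ℝ) × ℝ => q.1.1) := by fun_prop
  have hL : Measurable (fun q : (ℕ × ℝ × ℝ) × ℝ => q.1.2.1) := by fun_prop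
  have hR : Measurable (fun q : (ℕ × ℝ × ℝ) × ℝ => q.1.2.2) := by fun_prop
  have ht : Measurable (fun q : (ℕ × ℝ × ℝ) × ℝ => q.2) := by fun_prop
  have hm1 : Measurable (fun q : (ℕ × ℝ × ℝ) × ℝ => q.1.1 + 1) :=
    (measurable_of_countable (fun m : ℕ => m + 1)).comp hm
  unfold gapStep
  refine Measurable.ite ?_ (Measurable.ite ?_ ?_ (Measurable.ite ?_ ?_ ?_)) ?_
  · exact (measurableSet_lt hm measurable_const).inter ((measurableSet_lt hR ht).inter
      (measurableSet_lt ht (hL.const_sub 1)))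
  · exact measurableSet_lt (ht.sub hR) ((hL.const_sub 1).sub ht)
  · exact hm1.prodMk (hL.prodMk ht)
  · exact measurableSet_lt ((hL.const_sub 1).sub ht) (ht.sub hR)
  · exact hm1.prodMk ((ht.const_sub 1).prodMk hR)
  · exact measurable_const
  · exact measurable_fst

theorem measurable_gapState (K : ℕ) {n : ℕ} [NeZero n] (i : ℕ) :
    Measurable (fun x : Fin n → UnitAddCircle => gapState K x i) := by
  induction i with
  | zero => exact measurable_const
  | succ i ih =>
    unfold gapState
    split_ifs with h
    · have ho : Measurable (fun x : Fin n → UnitAddCircle => offset (x 0) (x ⟨i, h⟩)) :=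
        measurable_offset_pair.comp
          (f := fun x : Fin n → UnitAddCircle => (x 0, x ⟨i, h⟩)) ((measurable_pi_apply 0).prodMk (measurable_pi_apply _))
      exact (measurable_gapStep K).comp (ih.prodMk ho)
    · exact ih

/-- A supermartingale along the gap process. -/
noncomputable def gapWeight (K : ℕ) (s : ℕ × ℝ × ℝ) : ℝ≥0∞ :=
  ENNReal.ofReal ((((K : ℝ) + 1) / 2) ^ s.1 * (1 - s.2.1 - s.2.2) ^ K)

theorem measurable_gapWeight (K : ℕ) : Measurable (gapWeight K) := by
  unfold gapWeight
  refine ENNReal.measurable_ofReal.comp (Measurable.mul ?_ ?_)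
  · exact (measurable_of_countable (fun m : ℕ => (((K : ℝ) + 1) / 2) ^ m)).comp measurable_fst
  · exact Measurable.pow_const (by fun_prop) _

theorem integral_gap_pow (K : ℕ) (a b : ℝ) :
    ∫ t in a..b, ((b - t) ^ K + (t - a) ^ K) = 2 * (b - a) ^ (K + 1) / (K + 1) := by
  rw [intervalIntegral.integral_add (by apply Continuous.intervalIntegrable; fun_prop)
    (by apply Continuous.intervalIntegrable; fun_prop),
    intervalIntegral.integral_comp_sub_left (fun u => u ^ K),
    intervalIntegral.integral_comp_sub_right (fun u => u ^ K)]
  simp only [integral_pow, sub_self]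
  rw [zero_pow (by omega)]
  ring

/-- The `K`-th power of the larger piece is at most the sum of the `K`-th powers of both pieces,
whose integral over a gap of length `G` is `2 * G ^ (K + 1) / (K + 1)`. The factor `(K + 1) / 2`
gained by the step turns this into `G * G ^ K`, the share of the gap in the old weight. Arrivals
outside the gap change nothing. -/
theorem lintegral_gapWeight_step (K : ℕ) {s : ℕ × ℝ × ℝ} (hv : GapValid K s) :
    ∫⁻ t in Ioo (0 : ℝ) 1, gapWeight K (gapStep K s t) ≤ gapWeight K s := by
  rcases hv.1.eq_or_lt with hK | hK
  · simp [gapStep_of_eq hK]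
  obtain ⟨m, L, R⟩ := s
  obtain ⟨-, hL, hR, hLR⟩ := hv
  dsimp only at hL hR hLR hK
  set c : ℝ := ((K : ℝ) + 1) / 2 with hc
  have hc0 : 0 < c := by positivity
  set G : ℝ := 1 - L - R with hG
  have hG0 : 0 < G := by linarith
  have hsub : Ioo R (1 - L) ⊆ Ioo (0 : ℝ) 1 := Ioo_subset_Ioo hR (by linarith)
  rw [← lintegral_inter_add_sdiff _ (Ioo (0 : ℝ) 1) (measurableSet_Ioo (a := R) (b := 1 - L)),
    inter_eq_self_of_subset_right hsub]
  have hout : ∫⁻ t in Ioo (0 : ℝ) 1 \ Ioo R (1 - L), gapWeight K (gapStep K (m, L, R) t)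
      = gapWeight K (m, L, R) * ENNReal.ofReal (1 - G) := by
    rw [setLIntegral_congr_fun (g := fun _ => gapWeight K (m, L, R))
      (measurableSet_Ioo.diff measurableSet_Ioo), setLIntegral_const,
      measure_sdiff hsub measurableSet_Ioo.nullMeasurableSet (by simp), Real.volume_Ioo,
      Real.volume_Ioo, ← ENNReal.ofReal_sub _ (by linarith)]
    · congr 2; rw [hG]; ring
    · intro t ht
      rcases gapStep_cases K (m, L, R) t with ⟨h, -⟩ | ⟨-, h1, h2, -⟩
      · dsimp only; rw [h]
      · exact absurd ⟨h1, h2⟩ ht.2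
  have hin : ∫⁻ t in Ioo R (1 - L), gapWeight K (gapStep K (m, L, R) t)
      ≤ gapWeight K (m, L, R) * ENNReal.ofReal G := by
    calc ∫⁻ t in Ioo R (1 - L), gapWeight K (gapStep K (m, L, R) t)
        ≤ ∫⁻ t in Ioo R (1 - L),
            ENNReal.ofReal (c ^ (m + 1) * ((1 - L - t) ^ K + (t - R) ^ K)) := by
          -- A tie occurs only at the midpoint of the gap.
          have hne : ∀ᵐ t : ℝ, t ≠ (1 - L + R) / 2 := by simp [ae_iff]
          refine lintegral_mono_ae ?_
          filter_upwards [ae_restrict_of_ae hne, ae_restrict_mem measurableSet_Ioo] with t ht ht'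
          have hp1 : (0 : ℝ) ≤ (t - R) ^ K := pow_nonneg (by linarith [ht'.1]) _
          have hp2 : (0 : ℝ) ≤ (1 - L - t) ^ K := pow_nonneg (by linarith [ht'.2]) _
          have hp3 := pow_pos hc0 (m + 1)
          rcases gapStep_cases K (m, L, R) t with ⟨-, h⟩ | ⟨-, -, -, ⟨-, h⟩ | ⟨-, h⟩ | ⟨h, -⟩⟩
          · rcases h hK with h | h
            · exact absurd ht'.1 (not_lt.2 h)
            · exact absurd ht'.2 (not_lt.2 h)
          · rw [h]
            refine ENNReal.ofReal_le_ofReal (mul_le_mul_of_nonneg_left ?_ hp3.le)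
            dsimp only; linarith
          · rw [h]
            refine ENNReal.ofReal_le_ofReal (mul_le_mul_of_nonneg_left ?_ hp3.le)
            dsimp only
            rw [show 1 - (1 - t) - R = t - R by ring]; linarith
          · exact absurd (by dsimp only at h; linarith) ht
      _ = ENNReal.ofReal (∫ t in Ioo R (1 - L),
            c ^ (m + 1) * ((1 - L - t) ^ K + (t - R) ^ K)) := by
          rw [ofReal_integral_eq_lintegral_ofReal]
          · refine IntegrableOn.mono_set (t := Icc R (1 - L)) ?_ Ioo_subset_Icc_self
            exact Continuous.integrableOn_Icc (by fun_prop)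
          · filter_upwards [ae_restrict_mem measurableSet_Ioo] with t ht
            have h1 : (0 : ℝ) ≤ (t - R) ^ K := pow_nonneg (by linarith [ht.1]) _
            have h2 : (0 : ℝ) ≤ (1 - L - t) ^ K := pow_nonneg (by linarith [ht.2]) _
            have := pow_pos hc0 (m + 1)
            simp only [Pi.zero_apply]
            positivity
      _ = gapWeight K (m, L, R) * ENNReal.ofReal G := by
          rw [← integral_Ioc_eq_integral_Ioo, ← intervalIntegral.integral_of_le (by linarith),
            intervalIntegral.integral_const_mul, integral_gap_pow, gapWeight,
            ← ENNReal.ofReal_mul (by positivity)]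
          congr 1
          rw [show 1 - L - R = G from rfl, hc]
          field_simp
          ring
  calc _ ≤ gapWeight K (m, L, R) * ENNReal.ofReal G + gapWeight K (m, L, R) * ENNReal.ofReal (1 - G) :=
        add_le_add hin hout.le
    _ = gapWeight K (m, L, R) := by
        rw [← mul_add, ← ENNReal.ofReal_add hG0.le (by linarith)]; simp

/-- Integrating out one coordinate. -/
theorem lintegral_le_of_update {n : ℕ} {f g : (Fin n → UnitAddCircle) → ℝ≥0∞} (hf : Measurable f)
    (hg : Measurable g) (i : Fin n)
    (h : ∀ x, ∫⁻ y, f (Function.update x i y) ≤ ∫⁻ y, g (Function.update x i y)) :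
    ∫⁻ x, f x ≤ ∫⁻ x, g x := by
  refine lintegral_le_of_lmarginal_le (μ := fun _ : Fin n => (volume : Measure UnitAddCircle))
    {i} hf hg fun x => ?_
  rw [lmarginal_singleton, lmarginal_singleton]
  exact h x

/-- The state after `k` arrivals ignores later ones. The root is excluded because all offsets are
measured from it. -/
theorem gapState_update (K : ℕ) {n : ℕ} [NeZero n] (x : Fin n → UnitAddCircle) (i : Fin n)
    (hi : i ≠ 0) (y : UnitAddCircle) (k : ℕ) (hk : k ≤ i.val) :
    gapState K (Function.update x i y) k = gapState K x k := by
  induction k with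
  | zero => rfl
  | succ k ih =>
    unfold gapState
    rw [ih (by omega)]
    split_ifs with h
    · rw [Function.update_of_ne hi.symm, Function.update_of_ne]
      intro h'
      rw [← h'] at hk
      simp at hk
    · rfl

/-- The weight starts at `1`, and integrating out the newest vertex with the others fixed does not
increase it. -/
theorem lintegral_gapWeight_le (K : ℕ) {n : ℕ} [NeZero n] (i : ℕ) :
    ∫⁻ x : Fin n → UnitAddCircle, gapWeight K (gapState K x i) ≤ 1 := by
  induction i with
  | zero =>
    simp only [gapState, gapWeight]
    simp only [pow_zero, sub_zero, one_pow, mul_one, ENNReal.ofReal_one, lintegral_const, one_mul]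
    rw [volume_pi, Measure.pi_univ]
    simp
  | succ i ih =>
    refine le_trans ?_ ih
    by_cases h : i < n
    swap
    · simp [gapState, h]
    by_cases hi : i = 0
    · subst hi
      refine lintegral_mono fun x => le_of_eq ?_
      have : (⟨0, h⟩ : Fin n) = 0 := Fin.ext (by simp)
      simp [gapState, h, this, offset_self, gapStep]
    refine lintegral_le_of_update ((measurable_gapWeight K).comp (measurable_gapState K _))
      ((measurable_gapWeight K).comp (measurable_gapState K _)) ⟨i, h⟩ fun x => ?_
    have hi' : (⟨i, h⟩ : Fin n) ≠ 0 := fun h' => hi (by simpa using congrArg Fin.val h')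
    have h1 : ∀ y, gapWeight K (gapState K (Function.update x ⟨i, h⟩ y) (i + 1)) =
        gapWeight K (gapStep K (gapState K x i) (offset (x 0) y)) := by
      intro y
      rw [gapState, dif_pos h, gapState_update K x _ hi' y i le_rfl,
        Function.update_of_ne hi'.symm, Function.update_self]
    simp only [h1, gapState_update K x ⟨i, h⟩ hi' _ i le_rfl]
    rw [lintegral_offset (x 0) (fun t => gapWeight K (gapStep K (gapState K x i) t))]
    refine (lintegral_gapWeight_step K (gapValid_gapState K x i)).trans ?_
    simp

/-- Markov's inequality at the level `((K + 1) / 8) ^ K`, the weight of a stopped state with gap `1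
/ 4`, followed by `K! ≤ (K + 1) ^ K`. -/
theorem volume_gapBad_le (K : ℕ) {n : ℕ} [NeZero n] (i : ℕ) :
    volume {x : Fin n → UnitAddCircle | GapBad K (gapState K x i)} ≤
      ENNReal.ofReal (8 ^ K / K.factorial) := by
  have hpos : (0 : ℝ) < (((K : ℝ) + 1) / 8) ^ K := by positivity
  have hmk := mul_meas_ge_le_lintegral (μ := (volume : Measure (Fin n → UnitAddCircle)))
    ((measurable_gapWeight K).comp (measurable_gapState K (n := n) i))
    (ENNReal.ofReal ((((K : ℝ) + 1) / 8) ^ K))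
  have hsub : {x : Fin n → UnitAddCircle | GapBad K (gapState K x i)} ⊆
      {x | ENNReal.ofReal ((((K : ℝ) + 1) / 8) ^ K) ≤
        (gapWeight K ∘ fun x => gapState K x i) x} := by
    rintro x ⟨h1, h2⟩
    refine ENNReal.ofReal_le_ofReal ?_
    rw [h1, show ((K : ℝ) + 1) / 8 = ((K : ℝ) + 1) / 2 * (1 / 4) by ring, mul_pow]
    exact mul_le_mul_of_nonneg_left (pow_le_pow_left₀ (by norm_num) h2.le _) (by positivity)
  have h1 : ENNReal.ofReal ((((K : ℝ) + 1) / 8) ^ K) *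
      volume {x : Fin n → UnitAddCircle | GapBad K (gapState K x i)} ≤ 1 :=
    (mul_le_mul_right (measure_mono hsub) _).trans (hmk.trans (lintegral_gapWeight_le K i))
  have h2 : volume {x : Fin n → UnitAddCircle | GapBad K (gapState K x i)} ≤
      (ENNReal.ofReal ((((K : ℝ) + 1) / 8) ^ K))⁻¹ := by
    rw [ENNReal.le_inv_iff_mul_le, mul_comm]; exact h1
  refine h2.trans ?_
  rw [← ENNReal.ofReal_inv_of_pos hpos]
  refine ENNReal.ofReal_le_ofReal ?_
  rw [← inv_pow, inv_div, div_pow]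
  refine div_le_div_of_nonneg_left (by positivity) (by positivity) ?_
  calc (K.factorial : ℝ) ≤ (K : ℝ) ^ K := by exact_mod_cast Nat.factorial_le_pow K
    _ ≤ _ := pow_le_pow_left₀ (by positivity) (by linarith) _

theorem rootProb_confSet (K : ℕ) {n : ℕ} [NeZero n] {ε : ℝ} (h : 8 ^ K / K.factorial ≤ ε) :
    1 - ENNReal.ofReal ε ≤ rootProb (confSet K) n := by
  unfold rootProb
  refine tsub_le_tsub_left ((measure_mono ?_).trans
    ((volume_gapBad_le K n).trans (ENNReal.ofReal_le_ofReal h))) _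
  intro x hx
  by_contra hc
  exact hx (root_mem_confSet K x hc)

theorem volume_offset_mem (a : UnitAddCircle) {A : Set ℝ} (hA : MeasurableSet A) :
    volume {y | offset a y ∈ A} = volume (A ∩ Ioo 0 1) := by
  have h := lintegral_offset a (A.indicator 1)
  rw [lintegral_indicator_one hA, Measure.restrict_apply hA] at h
  rw [← h]
  exact (lintegral_indicator_one (μ := (volume : Measure UnitAddCircle))
    (measurable_offset a hA)).symm

/-! ### Ties -/

/-- The equidistant points are the midpoints of the two arcs between `a` and `b`. -/
theorem volume_dist_eq_dist {a b : UnitAddCircle} (h : a ≠ b) :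
    volume {y | dist y a = dist y b} = 0 := by
  have hfin : ({offset a b / 2, (offset a b + 1) / 2} : Set ℝ).Finite := by simp
  have h0 := volume_offset_mem a hfin.measurableSet
  rw [measure_mono_null inter_subset_left (hfin.measure_zero volume)] at h0
  refine measure_mono_null (fun y hy => ?_) h0
  have hc : 0 < offset a b := by
    refine (offset_nonneg a b).lt_of_ne fun h0 => h ?_
    exact offset_injective a (by rw [offset_self]; exact h0)
  have h1 := offset_lt_one a b
  have h2 := offset_nonneg a y
  have h3 := offset_lt_one a y
  simp only [mem_ofPred_eq] at hy
  rw [dist_eq_min_abs a y a, dist_eq_min_abs a y b, offset_self, sub_zero, abs_of_nonneg h2] at hy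
  simp only [mem_ofPred_eq, mem_insert_iff, mem_singleton_iff]
  rcases min_choice (offset a y) (1 - offset a y) with e1 | e1 <;>
    rcases min_choice |offset a y - offset a b| (1 - |offset a y - offset a b|) with e2 | e2 <;>
    rw [e1, e2] at hy <;>
    rcases abs_cases (offset a y - offset a b) with ⟨e3, e4⟩ | ⟨e3, e4⟩ <;> rw [e3] at hy <;>
    first
    | (exfalso; linarith)
    | (left; linarith)
    | (right; linarith)

/-- No vertex is at the same distance from two others. -/
def NoTie {n : ℕ} (x : Fin n → UnitAddCircle) : Prop :=
  ∀ ⦃i j l : Fin n⦄, i ≠ j → i ≠ l → j ≠ l → dist (x i) (x j) ≠ dist (x i) (x l)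

theorem volume_null_of_update {n : ℕ} {A : Set (Fin n → UnitAddCircle)} (hA : MeasurableSet A)
    (i : Fin n) (h : ∀ x, volume {y | Function.update x i y ∈ A} = 0) : volume A = 0 := by
  have := lintegral_le_of_update (f := A.indicator 1) (g := 0)
    (measurable_one.indicator hA) measurable_zero i fun x => by
      have hm : MeasurableSet {y | Function.update x i y ∈ A} :=
        measurable_update x hA
      have h' := lintegral_indicator_one (μ := (volume : Measure UnitAddCircle)) hm
      rw [h x] at h'
      simp only [Pi.zero_apply, lintegral_zero, nonpos_iff_eq_zero]
      exact h'
  rw [lintegral_indicator_one hA] at this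
  simpa using this

theorem volume_not_noTie (n : ℕ) : volume {x : Fin n → UnitAddCircle | ¬ NoTie x} = 0 := by
  -- Coincidences are removed first: if `x j = x l`, then every position of `x i` is a tie, and the
  -- slice in the coordinate `i` is not null.
  have hcoll : ∀ j l : Fin n, j ≠ l → volume {x : Fin n → UnitAddCircle | x j = x l} = 0 := by
    intro j l hjl
    refine volume_null_of_update
      (measurableSet_eq_fun (measurable_pi_apply j) (measurable_pi_apply l)) j fun x => ?_
    have h0 := volume_offset_mem (x l) (measurableSet_singleton 0)
    rw [measure_mono_null inter_subset_left (by simp)] at h0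
    refine measure_mono_null (fun y hy => ?_) h0
    simp only [mem_ofPred_eq, Function.update_self, Function.update_of_ne hjl.symm] at hy
    simp [hy, offset_self]
  have htie : ∀ i j l : Fin n, i ≠ j → i ≠ l → j ≠ l →
      volume {x : Fin n → UnitAddCircle | x j ≠ x l ∧ dist (x i) (x j) = dist (x i) (x l)} = 0 := by
    intro i j l hij hil hjl
    refine volume_null_of_update (MeasurableSet.inter
      (measurableSet_eq_fun (measurable_pi_apply j) (measurable_pi_apply l)).compl
      (measurableSet_eq_fun ((measurable_pi_apply i).dist (measurable_pi_apply j))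
        ((measurable_pi_apply i).dist (measurable_pi_apply l)))) i fun x => ?_
    by_cases hx : x j = x l
    · simp [Function.update_of_ne hij.symm, Function.update_of_ne hil.symm, hx]
    · refine measure_mono_null (fun y hy => ?_) (volume_dist_eq_dist hx)
      have hy2 := hy.2
      simpa [Function.update_of_ne hij.symm, Function.update_of_ne hil.symm] using hy2
  have hsub : {x : Fin n → UnitAddCircle | ¬ NoTie x} ⊆
      (⋃ (j : Fin n) (l : Fin n) (_ : j ≠ l), {x | x j = x l}) ∪
      ⋃ (i : Fin n) (j : Fin n) (l : Fin n) (_ : i ≠ j) (_ : i ≠ l) (_ : j ≠ l),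
        {x | x j ≠ x l ∧ dist (x i) (x j) = dist (x i) (x l)} := by
    intro x hx
    simp only [NoTie, mem_ofPred_eq] at hx
    push Not at hx
    obtain ⟨i, j, l, hij, hil, hjl, hd⟩ := hx
    by_cases hx : x j = x l
    · left
      simp only [mem_iUnion]
      exact ⟨j, l, hjl, hx⟩
    · right
      simp only [mem_iUnion]
      exact ⟨i, j, l, hij, hil, hjl, hx, hd⟩
  refine measure_mono_null hsub (measure_union_null ?_ ?_)
  · simp only [measure_iUnion_null_iff]
    exact hcoll
  · simp only [measure_iUnion_null_iff]
    exact htie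

theorem NoTie.nnParent_eq {n : ℕ} {x : Fin n → UnitAddCircle} (h : NoTie x) {i j : Fin n}
    (hj : IsNearest x i j) : nnParent x i = j := by
  have hi : 0 < i.val := lt_of_le_of_lt (Nat.zero_le _) (Fin.lt_def.1 hj.1)
  have hp := isNNTree_nnParent x i hi
  by_contra hne
  exact h hp.1.ne' hj.1.ne' hne (le_antisymm (hp.2 j hj.1) (hj.2 _ hp.1))

theorem NoTie.comp {n : ℕ} {x : Fin n → UnitAddCircle} (h : NoTie x) {σ : Fin n → Fin n}
    (hσ : Function.Injective σ) : NoTie (x ∘ σ) := fun _ _ _ hij hil hjl =>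
  h (hσ.ne hij) (hσ.ne hil) (hσ.ne hjl)

/-! ### Vertices in slots -/

/-- The `i`-th of `K` short intervals, which are spread over a quarter of the circle. -/
def slot (K i : ℕ) : Set ℝ := Ioo ((i : ℝ) / (4 * K)) ((i : ℝ) / (4 * K) + 1 / (16 * K))

/-- Within half a turn the circular distance is the plain difference of offsets. -/
theorem slot_subset {K i : ℕ} (h : i < K) : slot K i ⊆ Ioo 0 (1 / 2) := by
  have hK : (0 : ℝ) < K := by exact_mod_cast (Nat.zero_le i).trans_lt h
  have hi : (i : ℝ) + 1 ≤ K := by exact_mod_cast h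
  refine Ioo_subset_Ioo (by positivity) ?_
  rw [div_add_div _ _ (by positivity) (by positivity), div_le_div_iff₀ (by positivity) (by norm_num)]
  nlinarith

/-- `x` puts the vertex `i` in the slot `σ i`, as long as the latter is one of the `K` slots. -/
def InSlots (K : ℕ) {n : ℕ} (x : Fin n → UnitAddCircle) (σ : Fin n → ℕ) : Prop :=
  ∀ i, σ i < K → offset 0 (x i) ∈ slot K (σ i)

theorem dist_of_slots {K p q : ℕ} (hp : p < K) (hq : q < K) {a b : UnitAddCircle}
    (ha : offset 0 a ∈ slot K p) (hb : offset 0 b ∈ slot K q) :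
    dist a b = |offset 0 a - offset 0 b| := by
  have ha' := slot_subset hp ha
  have hb' := slot_subset hq hb
  rw [dist_eq_min_abs 0]
  refine min_eq_left ?_
  cases abs_cases (offset 0 a - offset 0 b) <;> linarith [ha'.1, ha'.2, hb'.1, hb'.2]

/-- In units of `1 / (16 K)`, slots have length `1` and consecutive ones start `4` apart. Points of
adjacent slots are thus less than `5` apart, while points of slots at least two steps apart are more
than `7` apart; the threshold `5` separates the two cases. -/
theorem dist_lt_of_slots {K p : ℕ} (hp : p + 1 < K) {a b : UnitAddCircle}
    (ha : offset 0 a ∈ slot K p) (hb : offset 0 b ∈ slot K (p + 1)) :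
    dist a b < 5 / (16 * K) := by
  have hK : (0 : ℝ) < K := by exact_mod_cast (Nat.zero_le _).trans_lt hp
  rw [dist_of_slots (by omega) hp ha hb]
  obtain ⟨h1, h2⟩ := ha
  obtain ⟨h3, h4⟩ := hb
  rw [abs_lt]
  push_cast at h3 h4
  have e1 : ((p : ℝ) + 1) / (4 * K) = p / (4 * K) + 4 / (16 * K) := by field_simp; ring
  have e2 : (5 : ℝ) / (16 * K) = 4 / (16 * K) + 1 / (16 * K) := by field_simp; norm_num
  have e3 : (0 : ℝ) < 1 / (16 * K) := by positivity
  have e4 : (4 : ℝ) / (16 * K) = 4 * (1 / (16 * K)) := by field_simp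
  constructor <;> linarith

theorem lt_dist_of_slots {K p q : ℕ} (hpq : p + 2 ≤ q) (hq : q < K) {a b : UnitAddCircle}
    (ha : offset 0 a ∈ slot K p) (hb : offset 0 b ∈ slot K q) :
    5 / (16 * K) < dist a b := by
  have hK : (0 : ℝ) < K := by exact_mod_cast (Nat.zero_le _).trans_lt hq
  rw [dist_of_slots (by omega) hq ha hb]
  obtain ⟨h1, h2⟩ := ha
  obtain ⟨h3, h4⟩ := hb
  have hc : (p : ℝ) + 2 ≤ q := by exact_mod_cast hpq
  have e1 : ((p : ℝ) + 2) / (4 * K) ≤ q / (4 * K) := by gcongr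
  have e2 : ((p : ℝ) + 2) / (4 * K) = p / (4 * K) + 8 * (1 / (16 * K)) := by field_simp; ring
  have e3 : (0 : ℝ) < 1 / (16 * K) := by positivity
  have e4 : (5 : ℝ) / (16 * K) = 5 * (1 / (16 * K)) := by field_simp
  rw [lt_abs]
  right
  linarith

theorem isNearest_of_slots {K n : ℕ} {x : Fin n → UnitAddCircle} {σ : Fin n → ℕ}
    (hx : InSlots K x σ) {i j : Fin n} (hji : j < i) (hσK : ∀ l ≤ i, σ l < K)
    (hadj : σ j + 1 = σ i ∨ σ i + 1 = σ j)
    (hfar : ∀ l < i, l ≠ j → σ l + 2 ≤ σ i ∨ σ i + 2 ≤ σ l) : IsNearest x i j := by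
  refine ⟨hji, fun l hl => ?_⟩
  by_cases hlj : l = j
  · rw [hlj]
  have hi := hx i (hσK i le_rfl)
  have hj := hx j (hσK j hji.le)
  have hl' := hx l (hσK l hl.le)
  have h1 : dist (x i) (x j) < 5 / (16 * K) := by
    rcases hadj with h | h
    · rw [dist_comm]
      exact dist_lt_of_slots (h ▸ hσK i le_rfl) hj (h ▸ hi)
    · exact dist_lt_of_slots (h ▸ hσK j hji.le) hi (h ▸ hj)
  have h2 : 5 / (16 * K) < dist (x i) (x l) := by
    rcases hfar l hl hlj with h | h
    · rw [dist_comm]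
      exact lt_dist_of_slots h (hσK i le_rfl) hl' hi
    · exact lt_dist_of_slots h (hσK l hl.le) hi hl'
  linarith

/-- Reversal of the first `k + 1` indices. -/
def revInit {n : ℕ} (k i : Fin n) : Fin n :=
  if i ≤ k then ⟨k - i, (Nat.sub_le _ _).trans_lt k.isLt⟩ else i

theorem revInit_of_le {n : ℕ} {k i : Fin n} (h : i ≤ k) : (revInit k i).val = k - i := by
  simp [revInit, h]

theorem revInit_of_lt {n : ℕ} {k i : Fin n} (h : k < i) : revInit k i = i := by
  simp [revInit, not_le.2 h]

theorem revInit_involutive {n : ℕ} (k : Fin n) : Function.Involutive (revInit k) := by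
  intro i
  rcases le_or_gt i k with h | h
  · have h1 := revInit_of_le h
    have h2 : revInit k i ≤ k := by rw [Fin.le_def, h1]; omega
    refine Fin.ext ?_
    rw [revInit_of_le h2, h1]
    rw [Fin.le_def] at h
    omega
  · rw [revInit_of_lt h, revInit_of_lt h]

theorem revInit_lt {n : ℕ} {k i l : Fin n} (hk : k < i) (h : l < i) : revInit k l < i := by
  rcases le_or_gt l k with h' | h'
  · rw [Fin.lt_def, revInit_of_le h']
    rw [Fin.lt_def] at hk
    omega
  · rwa [revInit_of_lt h']

/-- The index of the edge of the original tree that becomes the edge above the vertex `i`. -/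
def revEdge {n : ℕ} (k i : Fin n) : Fin n :=
  if h : 0 < i.val ∧ i ≤ k then ⟨k + 1 - i, by have := h.1; have := k.isLt; omega⟩ else i

theorem revEdge_pos {n : ℕ} (k : Fin n) {i : Fin n} (h : 0 < i.val) : 0 < (revEdge k i).val := by
  unfold revEdge
  split_ifs with h'
  · have := Fin.le_def.1 h'.2
    simp only
    omega
  · exact h

theorem revEdge_revEdge {n : ℕ} (k : Fin n) {i : Fin n} (h : 0 < i.val) :
    revEdge k (revEdge k i) = i := by
  by_cases h' : i ≤ k
  · have h1 : (revEdge k i).val = k + 1 - i := by simp [revEdge, h, h']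
    have h2 := Fin.le_def.1 h'
    have h3 : 0 < (revEdge k i).val ∧ revEdge k i ≤ k :=
      ⟨revEdge_pos k h, by rw [Fin.le_def, h1]; omega⟩
    refine Fin.ext ?_
    have h4 : (revEdge k (revEdge k i)).val = k + 1 - (revEdge k i).val := by
      generalize revEdge k i = j at h3
      simp [revEdge, h3]
    omega
  · have h1 : revEdge k i = i := by simp [revEdge, h']
    rw [h1, h1]

/-- Each edge of the reversed arrival order is an edge of the original tree. On the path part the
slots determine all parents; for a later vertex the set of earlier points is unchanged, hence so is
the nearest one. -/
theorem edge_revInit {K n : ℕ} {x : Fin n → UnitAddCircle}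
    (hx : InSlots K x (fun i => i)) (hT : NoTie x) {k : Fin n} (hk : k.val < K) {i : Fin n}
    (hi : 0 < i.val) :
    s((x ∘ revInit k) i, (x ∘ revInit k) (nnParent (x ∘ revInit k) i)) =
      s(x (revEdge k i), x (nnParent x (revEdge k i))) := by
  have hT' : NoTie (x ∘ revInit k) := hT.comp (revInit_involutive k).injective
  have hx' : InSlots K (x ∘ revInit k) (fun i => (revInit k i).val) := fun i h => hx _ h
  have hpx : ∀ (a b : Fin n), b.val + 1 = a.val → a.val < K → nnParent x a = b := by
    intro a b hab haK
    refine hT.nnParent_eq (isNearest_of_slots hx (Fin.lt_def.2 (by omega)) (fun l hl => ?_)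
      (Or.inl hab) (fun l hl hlb => Or.inl ?_))
    · have := Fin.le_def.1 hl; omega
    · have := Fin.lt_def.1 hl
      have : l.val ≠ b.val := fun h => hlb (Fin.ext h)
      omega
  have hlt : ∀ l : Fin n, l.val < K → (revInit k l).val < K := by
    intro l hl
    rcases le_or_gt l k with h | h
    · rw [revInit_of_le h]; omega
    · rwa [revInit_of_lt h]
  rcases lt_or_ge i.val K with hiK | hiK
  · by_cases hik : i ≤ k
    · have hik' := Fin.le_def.1 hik
      set j : Fin n := ⟨i - 1, by have := i.isLt; omega⟩ with hj
      have hjk : j ≤ k := Fin.le_def.2 (by simp only [hj]; omega)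
      have e1 : (revInit k i).val = k - i := revInit_of_le hik
      have e2 : (revInit k j).val = k + 1 - i := by
        rw [revInit_of_le hjk]; simp only [hj]; omega
      have e3 : revEdge k i = revInit k j := by
        refine Fin.ext ?_
        rw [e2]
        simp [revEdge, hi, hik]
      have hp : nnParent (x ∘ revInit k) i = j := by
        refine hT'.nnParent_eq (isNearest_of_slots hx' (Fin.lt_def.2 (by simp only [hj]; omega))
          (fun l hl => hlt l ?_) (Or.inr ?_) (fun l hl hlj => Or.inr ?_))
        · have := Fin.le_def.1 hl; omega
        · rw [e1, e2]; omega
        · have h1 := Fin.lt_def.1 hl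
          have h2 : l.val ≠ i.val - 1 := fun h => hlj (Fin.ext h)
          rw [e1, revInit_of_le (hl.le.trans hik)]; omega
      rw [hp, e3, hpx (revInit k j) (revInit k i) (by rw [e1, e2]; omega)
        (by rw [e2]; omega)]
      exact Sym2.eq_swap
    · have hik' : k < i := not_le.1 hik
      have hik'' := Fin.lt_def.1 hik'
      have e1 : revInit k i = i := revInit_of_lt hik'
      have e3 : revEdge k i = i := by simp [revEdge, hik]
      -- For `k < i < K` the only earlier vertex in a slot adjacent to slot `i` is the one in slot
      -- `i - 1`, in either order of arrival.
      set b : Fin n := ⟨i - 1, by have := i.isLt; omega⟩ with hb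
      have hbk : k ≤ b := Fin.le_def.2 (by simp only [hb]; omega)
      have e2 : revInit k (revInit k b) = b := revInit_involutive k b
      have hrl : ∀ l < i, (revInit k l) < i := fun l hl => revInit_lt hik' hl
      have hp : nnParent (x ∘ revInit k) i = revInit k b := by
        refine hT'.nnParent_eq (isNearest_of_slots hx' ?_
          (fun l hl => hlt l ?_) (Or.inl ?_) (fun l hl hlj => Or.inl ?_))
        · exact hrl b (Fin.lt_def.2 (by simp only [hb]; omega))
        · have := Fin.le_def.1 hl; omega
        · rw [e1, e2]; simp only [hb]; omega
        · have h1 := Fin.lt_def.1 (hrl l hl)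
          have h2 : revInit k l ≠ b := fun h => hlj (by rw [← h, revInit_involutive k l])
          have h3 : (revInit k l).val ≠ i.val - 1 := fun h => h2 (Fin.ext h)
          rw [e1]; omega
      rw [hp, e3, hpx i b (by simp only [hb]; omega) hiK]
      simp [e1, e2]
  · have hik' : k < i := Fin.lt_def.2 (by omega)
    have e1 : revInit k i = i := revInit_of_lt hik'
    have e3 : revEdge k i = i := by simp [revEdge, hik']
    set q := nnParent (x ∘ revInit k) i with hq
    have hn : IsNearest (x ∘ revInit k) i q := isNNTree_nnParent _ i hi
    have hp : nnParent x i = revInit k q := by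
      refine hT.nnParent_eq ⟨revInit_lt hik' hn.1, fun l hl => ?_⟩
      have := hn.2 (revInit k l) (revInit_lt hik' hl)
      simpa [e1, revInit_involutive k l] using this
    rw [e3, hp]
    simp [e1]

/-- `revEdge k` is an involution of the non-root indices that matches the edges, so one inclusion
gives both. -/
theorem nnTree_revInit {K n : ℕ} {x : Fin n → UnitAddCircle}
    (hx : InSlots K x (fun i => i)) (hT : NoTie x) {k : Fin n} (hk : k.val < K) :
    nnTree (x ∘ revInit k) = nnTree x := by
  classical
  refine EmbTree.ext (Finset.ext fun y => ?_) (Finset.ext fun e => ?_)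
  · simp only [nnTree, embTree, Finset.mem_image, Finset.mem_univ, true_and]
    constructor
    · rintro ⟨i, rfl⟩; exact ⟨_, rfl⟩
    · rintro ⟨i, rfl⟩
      exact ⟨revInit k i, by simp [revInit_involutive k i]⟩
  · simp only [nnTree, embTree, Finset.mem_image, Finset.mem_filter, Finset.mem_univ, true_and]
    constructor
    · rintro ⟨i, hi, rfl⟩
      exact ⟨revEdge k i, revEdge_pos k hi, (edge_revInit hx hT hk hi).symm⟩
    · rintro ⟨i, hi, rfl⟩
      refine ⟨revEdge k i, revEdge_pos k hi, ?_⟩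
      rw [edge_revInit hx hT hk (revEdge_pos k hi), revEdge_revEdge k hi]

/-! ### Probability of missing the root -/

theorem volume_inSlots {K n : ℕ} (hK : 0 < K) (hKn : K ≤ n) :
    volume {x : Fin n → UnitAddCircle | InSlots K x (fun i => i)} =
      ENNReal.ofReal ((1 / (16 * K)) ^ K) := by
  classical
  have hset : {x : Fin n → UnitAddCircle | InSlots K x (fun i => i)} =
      Set.pi univ fun i : Fin n => {y | i.val < K → offset 0 y ∈ slot K i} := by
    ext x; simp [InSlots, Set.mem_pi]
  have hv : ∀ i : Fin n, volume {y : UnitAddCircle | i.val < K → offset 0 y ∈ slot K i} =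
      if i.val < K then ENNReal.ofReal (1 / (16 * K)) else 1 := by
    intro i
    split_ifs with h
    · simp only [h, true_imp_iff]
      rw [volume_offset_mem 0 (A := slot K i) measurableSet_Ioo, inter_eq_left.2, slot,
        Real.volume_Ioo]
      · congr 1; ring
      · exact (slot_subset h).trans (Ioo_subset_Ioo_right (by norm_num))
    · simp [h]
  rw [hset, volume_pi_pi]
  simp only [hv]
  rw [Finset.prod_ite]
  simp only [Finset.prod_const, one_pow, mul_one]
  rw [Fin.card_filter_val_lt, min_eq_right hKn, ENNReal.ofReal_pow (by positivity)]

/-- A procedure that returns fewer than `K` vertices misses the root with probability at least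
`(1 / (16 K)) ^ K / K`. -/
theorem le_volume_miss {K n : ℕ} [NeZero n] (hK : 0 < K) (hKn : K ≤ n) (H : Procedure)
    (hH : ∀ x : Fin n → UnitAddCircle, (H (nnTree x)).card < K) :
    ENNReal.ofReal ((1 / (16 * K)) ^ K / K) ≤
      volume {x : Fin n → UnitAddCircle | x 0 ∉ H (nnTree x)} := by
  classical
  set F := {x : Fin n → UnitAddCircle | x 0 ∉ H (nnTree x)} with hF
  set E := {x : Fin n → UnitAddCircle | InSlots K x (fun i => i)} with hE
  set I : Finset (Fin n) := Finset.univ.filter fun k => k.val < K with hI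
  have hIcard : I.card = K := by rw [hI, Fin.card_filter_val_lt, min_eq_right hKn]
  -- Permuting coordinates is a measure-preserving equivalence, so this holds although `F` need not
  -- be measurable.
  have hpre : ∀ k : Fin n, volume ((fun x : Fin n → UnitAddCircle => x ∘ revInit k) ⁻¹' F) =
      volume F := by
    intro k
    have hmp := volume_preserving_arrowCongr' (revInit_involutive k).toPerm
      (MeasurableEquiv.refl UnitAddCircle) (MeasurePreserving.id _)
    have := hmp.measure_preimage_equiv F
    rw [← this]
    rfl
  have hcov : E ⊆ {x | ¬ NoTie x} ∪
      ⋃ k ∈ I, (fun x : Fin n → UnitAddCircle => x ∘ revInit k) ⁻¹' F := by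
    intro x hx
    by_cases hT : NoTie x
    swap
    · exact Or.inl hT
    right
    have hinj : Set.InjOn x I := by
      intro a ha b hb hab
      have ha' := (Finset.mem_filter.1 ha).2
      have hb' := (Finset.mem_filter.1 hb).2
      by_contra hne
      have hK' : (0 : ℝ) < K := by exact_mod_cast hK
      have key : ∀ p q : Fin n, p.val < q.val → q.val < K → x p = x q → False := by
        intro p q hpq hq he
        have h1 := (hx p (hpq.trans hq)).2
        have h2 := (hx q hq).1
        rw [he] at h1
        have hc : ((p.val : ℝ) + 1) ≤ q.val := by exact_mod_cast hpq
        have e1 : ((p.val : ℝ) + 1) / (4 * K) ≤ q.val / (4 * K) := by gcongr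
        have e2 : ((p.val : ℝ) + 1) / (4 * K) = p.val / (4 * K) + 4 * (1 / (16 * K)) := by
          field_simp; ring
        have e3 : (0 : ℝ) < 1 / (16 * K) := by positivity
        linarith
      rcases lt_or_gt_of_ne (fun h => hne (Fin.ext h) : a.val ≠ b.val) with h | h
      · exact key a b h hb' hab
      · exact key b a h ha' hab.symm
    -- Pigeonhole: the `K` path vertices are distinct, and fewer than `K` points are returned.
    have hex : ∃ k ∈ I, x k ∉ H (nnTree x) := by
      by_contra! hc
      have h1 : (I.image x).card ≤ (H (nnTree x)).card :=
        Finset.card_le_card fun y hy => by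
          obtain ⟨k, hk, rfl⟩ := Finset.mem_image.1 hy
          exact hc k hk
      rw [Finset.card_image_of_injOn hinj, hIcard] at h1
      exact absurd (hH x) (not_lt.2 h1)
    obtain ⟨k, hk, hkH⟩ := hex
    simp only [mem_iUnion]
    refine ⟨k, hk, ?_⟩
    have hk' := (Finset.mem_filter.1 hk).2
    change (x ∘ revInit k) 0 ∉ H (nnTree (x ∘ revInit k))
    rw [nnTree_revInit hx hT hk']
    have : revInit k 0 = k := Fin.ext (by rw [revInit_of_le (Fin.zero_le k)]; simp)
    simpa [this] using hkH
  have h1 : volume E ≤ K * volume F := by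
    calc volume E ≤ volume {x : Fin n → UnitAddCircle | ¬ NoTie x} +
          volume (⋃ k ∈ I, (fun x : Fin n → UnitAddCircle => x ∘ revInit k) ⁻¹' F) :=
          (measure_mono hcov).trans (measure_union_le _ _)
      _ ≤ 0 + ∑ k ∈ I, volume ((fun x : Fin n → UnitAddCircle => x ∘ revInit k) ⁻¹' F) :=
          add_le_add (volume_not_noTie n).le (measure_biUnion_finset_le _ _)
      _ = K * volume F := by
          simp only [hpre, Finset.sum_const, hIcard, zero_add, nsmul_eq_mul]
  rw [hE, volume_inSlots hK hKn] at h1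
  have hK' : (0 : ℝ) < K := by exact_mod_cast hK
  rw [ENNReal.ofReal_div_of_pos hK', ENNReal.ofReal_natCast]
  exact ENNReal.div_le_of_le_mul' h1

theorem rootProb_le {K n : ℕ} [NeZero n] (hK : 0 < K) (hKn : K ≤ n) (H : Procedure)
    (hH : ∀ x : Fin n → UnitAddCircle, (H (nnTree x)).card < K) :
    rootProb H n ≤ 1 - ENNReal.ofReal ((1 / (16 * K)) ^ K / K) :=
  tsub_le_tsub_left (le_volume_miss hK hKn H hH) _

/-! ### Reasoning about programs -/

/-- From every state with `Pre`, the program halts within time `c` in a state with `Post`. -/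
def Runs (P : Prog) (c : ℕ) (Pre Post : State → Prop) : Prop :=
  ∀ s, Pre s → ∃ s' t, Exec P s s' t ∧ t ≤ c ∧ Post s'

theorem Runs.seq {P Q : Prog} {c d : ℕ} {A B C : State → Prop} (h : Runs P c A B)
    (h' : Runs Q d B C) : Runs (.seq P Q) (c + d) A C := by
  intro s hs
  obtain ⟨s', t, h1, h2, h3⟩ := h s hs
  obtain ⟨s'', t', h1', h2', h3'⟩ := h' s' h3
  exact ⟨s'', t + t', .seq h1 h1', by omega, h3'⟩

theorem Runs.ite {b : Test} {P Q : Prog} {c : ℕ} {A C : State → Prop}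
    (h : Runs P c (fun s => A s ∧ b.holds s) C) (h' : Runs Q c (fun s => A s ∧ ¬ b.holds s) C) :
    Runs (.ite b P Q) (b.cost + 1 + c) A C := by
  intro s hs
  by_cases hb : b.holds s
  · obtain ⟨s', t, h1, h2, h3⟩ := h s ⟨hs, hb⟩
    exact ⟨s', _, .iteTrue hb h1, by omega, h3⟩
  · obtain ⟨s', t, h1, h2, h3⟩ := h' s ⟨hs, hb⟩
    exact ⟨s', _, .iteFalse hb h1, by omega, h3⟩

theorem Runs.mono {P : Prog} {c d : ℕ} {A B : State → Prop} (h : Runs P c A B) (hcd : c ≤ d) :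
    Runs P d A B := by
  intro s hs
  obtain ⟨s', t, h1, h2, h3⟩ := h s hs
  exact ⟨s', t, h1, h2.trans hcd, h3⟩

theorem Runs.conseq {P : Prog} {c : ℕ} {A A' B B' : State → Prop} (h : Runs P c A B)
    (hA : ∀ s, A' s → A s) (hB : ∀ s, B s → B' s) : Runs P c A' B' := by
  intro s hs
  obtain ⟨s', t, h1, h2, h3⟩ := h s (hA s hs)
  exact ⟨s', t, h1, h2, hB s' h3⟩

/-- A loop with an invariant indexed by the number of rounds. -/
theorem Runs.while {b : Test} {P : Prog} (Inv : ℕ → State → Prop) (N c : ℕ)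
    (hb : ∀ k s, k < N → Inv k s → b.holds s) (hend : ∀ s, Inv N s → ¬ b.holds s)
    (hP : ∀ k, k < N → Runs P c (Inv k) (Inv (k + 1))) :
    Runs (.while b P) (N * (b.cost + 1 + c) + (b.cost + 1)) (Inv 0) (Inv N) := by
  have key : ∀ m k s, k + m = N → Inv k s → ∃ s' t, Exec (.while b P) s s' t ∧
      t ≤ m * (b.cost + 1 + c) + (b.cost + 1) ∧ Inv N s' := by
    intro m
    induction m with
    | zero =>
      intro k s hk hs
      obtain rfl : k = N := by omega
      exact ⟨s, _, .whileFalse (hend s hs), by omega, hs⟩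
    | succ m ih =>
      intro k s hk hs
      obtain ⟨s', t, h1, h2, h3⟩ := hP k (by omega) s hs
      obtain ⟨s'', t', h1', h2', h3'⟩ := ih (k + 1) s' (by omega) h3
      refine ⟨s'', _, .whileTrue (hb k s (by omega) hs) h1 h1', ?_, h3'⟩
      rw [Nat.succ_mul]
      omega
  intro s hs
  exact key N 0 s (by omega) hs

/-- Programs without loops. -/
def Prog.LoopFree : Prog → Prop
  | .skip => True
  | .setNat _ _ _ => True
  | .setReal _ _ _ => True
  | .seq P Q => P.LoopFree ∧ Q.LoopFree
  | .ite _ P Q => P.LoopFree ∧ Q.LoopFree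
  | .while _ _ => False

open Classical in
/-- The effect of a program without loops. -/
noncomputable def Prog.run : Prog → State → State
  | .skip, s => s
  | .setNat a i e, s => s.setNat a (i.eval s) (e.eval s)
  | .setReal a i e, s => s.setReal a (i.eval s) (e.eval s)
  | .seq P Q, s => Q.run (P.run s)
  | .ite b P Q, s => if b.holds s then P.run s else Q.run s
  | .while _ _, s => s

/-- A bound for the running time of a program without loops. -/
def Prog.maxCost : Prog → ℕ
  | .skip => 1
  | .setNat _ i e => i.cost + e.cost + 1
  | .setReal _ i e => i.cost + e.cost + 1
  | .seq P Q => P.maxCost + Q.maxCost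
  | .ite b P Q => b.cost + 1 + (P.maxCost + Q.maxCost)
  | .while _ _ => 0

theorem Prog.exec_run {P : Prog} (h : P.LoopFree) (s : State) :
    ∃ t, Exec P s (P.run s) t ∧ t ≤ P.maxCost := by
  induction P generalizing s with
  | skip => exact ⟨_, .skip s, le_rfl⟩
  | setNat a i e => exact ⟨_, .setNat s a i e, le_rfl⟩
  | setReal a i e => exact ⟨_, .setReal s a i e, le_rfl⟩
  | seq P Q ihP ihQ =>
    obtain ⟨t, h1, h2⟩ := ihP h.1 s
    obtain ⟨t', h1', h2'⟩ := ihQ h.2 (P.run s)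
    exact ⟨_, .seq h1 h1', add_le_add h2 h2'⟩
  | ite b P Q ihP ihQ =>
    obtain ⟨t, h1, h2⟩ := ihP h.1 s
    obtain ⟨t', h1', h2'⟩ := ihQ h.2 s
    by_cases hb : b.holds s
    · exact ⟨_, by simpa [Prog.run, hb] using Exec.iteTrue (Q := Q) hb h1,
        by simp only [Prog.maxCost]; omega⟩
    · exact ⟨_, by simpa [Prog.run, hb] using Exec.iteFalse (P := P) hb h1',
        by simp only [Prog.maxCost]; omega⟩
  | _ => exact h.elim

theorem Runs.of_loopFree {P : Prog} (h : P.LoopFree) {A B : State → Prop}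
    (hAB : ∀ s, A s → B (P.run s)) : Runs P P.maxCost A B := by
  intro s hs
  obtain ⟨t, h1, h2⟩ := P.exec_run h s
  exact ⟨_, t, h1, h2, hAB s hs⟩

/-! ### Building blocks -/

/-- The natural number register `a`. -/
def nreg (a : ℕ) : NExpr := .read a (.const 0)

/-- The real register `a`. -/
def rreg (a : ℕ) : RExpr := .read a (.const 0)

@[simp] theorem eval_nreg (a : ℕ) (s : State) : (nreg a).eval s = s.nats a 0 := rfl

@[simp] theorem eval_rreg (a : ℕ) (s : State) : (rreg a).eval s = s.reals a 0 := rfl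

@[simp] theorem cost_nreg (a : ℕ) : (nreg a).cost = 2 := rfl

@[simp] theorem cost_rreg (a : ℕ) : (rreg a).cost = 2 := rfl

/-- Circular distance of coordinates. -/
noncomputable def coordDist (X Y : ℝ) : ℝ := min |X - Y| (1 - |X - Y|)

/-- Circular offset of coordinates. -/
noncomputable def coordOffset (X Y : ℝ) : ℝ := if 0 ≤ Y - X then Y - X else Y - X + 1

/-- Store the circular distance of `X` and `Y` in the real register `a`. -/
def distProg (a : ℕ) (X Y : RExpr) : Prog :=
  .seq (.setReal a (.const 0) (.sub X Y)) <|
  .seq (.ite (.rle (.ofNat (.const 0)) (rreg a)) .skip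
    (.setReal a (.const 0) (.sub (.ofNat (.const 0)) (rreg a)))) <|
  .ite (.rle (rreg a) (.sub (.ofNat (.const 1)) (rreg a))) .skip
    (.setReal a (.const 0) (.sub (.ofNat (.const 1)) (rreg a)))

theorem State.setReal_setReal (s : State) (a i : ℕ) (v w : ℝ) :
    (s.setReal a i v).setReal a i w = s.setReal a i w := by
  simp [State.setReal]

@[simp] theorem State.setReal_apply_self (s : State) (a i : ℕ) (v : ℝ) :
    (s.setReal a i v).reals a i = v := by
  simp [State.setReal]

theorem run_distProg (a : ℕ) (X Y : RExpr) (s : State) :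
    (distProg a X Y).run s = s.setReal a 0 (coordDist (X.eval s) (Y.eval s)) := by
  have h1 : ∀ v : ℝ, (Prog.ite (.rle (.ofNat (.const 0)) (rreg a)) .skip
      (.setReal a (.const 0) (.sub (.ofNat (.const 0)) (rreg a)))).run (s.setReal a 0 v) =
      s.setReal a 0 |v| := by
    intro v
    by_cases h : 0 ≤ v
    · simp [Prog.run, Test.holds, RExpr.eval, NExpr.eval, h, abs_of_nonneg h]
    · simp [Prog.run, Test.holds, RExpr.eval, NExpr.eval, h, abs_of_neg (not_le.1 h),
        State.setReal_setReal]
  have h2 : ∀ v : ℝ, (Prog.ite (.rle (rreg a) (.sub (.ofNat (.const 1)) (rreg a))) .skip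
      (.setReal a (.const 0) (.sub (.ofNat (.const 1)) (rreg a)))).run (s.setReal a 0 v) =
      s.setReal a 0 (min v (1 - v)) := by
    intro v
    by_cases h : v ≤ 1 - v
    · simp [Prog.run, Test.holds, RExpr.eval, NExpr.eval, h]
    · simp [Prog.run, Test.holds, RExpr.eval, NExpr.eval, h, min_eq_right (not_le.1 h).le,
        State.setReal_setReal]
  rw [distProg, Prog.run, Prog.run, Prog.run]
  exact (congrArg _ (h1 _)).trans (h2 _)

/-- Store the circular offset from `X` to `Y` in the real register `a`. -/
def offsetProg (a : ℕ) (X Y : RExpr) : Prog :=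
  .seq (.setReal a (.const 0) (.sub Y X)) <|
  .ite (.rle (.ofNat (.const 0)) (rreg a)) .skip
    (.setReal a (.const 0) (.add (rreg a) (.ofNat (.const 1))))

theorem run_offsetProg (a : ℕ) (X Y : RExpr) (s : State) :
    (offsetProg a X Y).run s = s.setReal a 0 (coordOffset (X.eval s) (Y.eval s)) := by
  rw [offsetProg, Prog.run, Prog.run, coordOffset]
  by_cases h : 0 ≤ Y.eval s - X.eval s
  · simp [Prog.run, Test.holds, RExpr.eval, NExpr.eval, h, -sub_nonneg]
  · simp [Prog.run, Test.holds, RExpr.eval, NExpr.eval, h, -sub_nonneg, State.setReal_setReal]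

/-- Add one to the natural number register `a`. -/
def incr (a : ℕ) : Prog := .setNat a (.const 0) (.add (nreg a) (.const 1))

/-! ### The program -/

/-- The input of the program as it appears in the memory. -/
structure Input where
  n : ℕ
  e₁ : ℕ → ℕ
  e₂ : ℕ → ℕ
  pos : ℕ → ℝ
  ε : ℝ

/-- The memory contains the input `E`. -/
structure Input.In (E : Input) (s : State) : Prop where
  n : s.nats 0 0 = E.n
  e₁ : s.nats 1 = E.e₁
  e₂ : s.nats 2 = E.e₂
  pos : s.reals 1 = E.pos
  ε : s.reals 0 0 = E.ε

/-- The edge `j` covers the vertex `i`. -/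
def Input.EdgeCovers (E : Input) (i j : ℕ) : Prop :=
  coordDist (E.pos i) (E.pos (E.e₁ j)) < coordDist (E.pos (E.e₁ j)) (E.pos (E.e₂ j)) ∧
  coordDist (E.pos i) (E.pos (E.e₂ j)) < coordDist (E.pos (E.e₁ j)) (E.pos (E.e₂ j))

/-- `j + 2 ≤ E.n` says `j < E.n - 1`, the range of the edge list, without truncated subtraction. -/
def Input.Covered (E : Input) (i : ℕ) : Prop := ∃ j, j + 2 ≤ E.n ∧ E.EdgeCovers i j

open Classical in
/-- The uncovered vertices among the first `k` that are shortly after the vertex `i`. -/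
noncomputable def Input.after (E : Input) (i k : ℕ) : Finset ℕ :=
  (Finset.range k).filter fun j => ¬ E.Covered j ∧
    0 < coordOffset (E.pos i) (E.pos j) ∧ coordOffset (E.pos i) (E.pos j) ≤ 1 / 4

open Classical in
/-- The uncovered vertices among the first `k` that are shortly before the vertex `i`. -/
noncomputable def Input.before (E : Input) (i k : ℕ) : Finset ℕ :=
  (Finset.range k).filter fun j => ¬ E.Covered j ∧ 3 / 4 ≤ coordOffset (E.pos i) (E.pos j)

/-- The vertex `i` is uncovered and sparse in one direction. -/
def Input.Sparse (E : Input) (K i : ℕ) : Prop :=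
  ¬ E.Covered i ∧ ((E.after i E.n).card ≤ K + 1 ∨ (E.before i E.n).card ≤ K + 1)

open Classical in
/-- The sparse vertices among the first `k`. -/
noncomputable def Input.sparse (E : Input) (K k : ℕ) : Finset ℕ :=
  (Finset.range k).filter fun i => E.Sparse K i

/-- Compute the parameter of the confidence set. -/
def paramBody : Prog :=
  .seq (incr 4)
    (.setReal 2 (.const 0) (.div (.mul (rreg 2) (.ofNat (.const 8))) (.ofNat (nreg 4))))

/-- Each round multiplies `8 ^ k / k!` by `8 / (k + 1)`, until the value is at most `ε`. The
parameter is thus found in time linear in its value, without logarithms. -/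
def paramProg : Prog :=
  .seq (.setReal 2 (.const 0) (.ofNat (.const 1)))
    (.while (.not (.rle (rreg 2) (rreg 0))) paramBody)

/-- Flag the vertex in register 6 if it is covered by the edge in register 7. -/
def coverBody : Prog :=
  .seq (distProg 3 (.read 1 (nreg 6)) (.read 1 (.read 1 (nreg 7)))) <|
  .seq (distProg 4 (.read 1 (nreg 6)) (.read 1 (.read 2 (nreg 7)))) <|
  .seq (distProg 5 (.read 1 (.read 1 (nreg 7))) (.read 1 (.read 2 (nreg 7)))) <|
  .seq (.ite (.and (.not (.rle (rreg 5) (rreg 3))) (.not (.rle (rreg 5) (rreg 4))))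
    (.setNat 5 (nreg 6) (.const 1)) .skip) <|
  incr 7

def coverProg : Prog :=
  .while (.not (.nle (nreg 0) (nreg 6))) <|
    .seq (.setNat 7 (.const 0) (.const 0)) <|
    .seq (.while (.nle (.add (nreg 7) (.const 2)) (nreg 0)) coverBody) <|
    incr 6

/-- Count the vertex in register 7 if it is close to the vertex in register 6. -/
def countBody : Prog :=
  .seq (offsetProg 3 (.read 1 (nreg 6)) (.read 1 (nreg 7))) <|
  .seq (.ite (.and (.nle (.read 5 (nreg 7)) (.const 0))
      (.and (.not (.rle (rreg 3) (.ofNat (.const 0))))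
        (.rle (rreg 3) (.div (.ofNat (.const 1)) (.ofNat (.const 4))))))
    (incr 8) .skip) <|
  .seq (.ite (.and (.nle (.read 5 (nreg 7)) (.const 0))
      (.rle (.div (.ofNat (.const 3)) (.ofNat (.const 4))) (rreg 3)))
    (incr 9) .skip) <|
  incr 7

/-- Select the vertex in register 6 if it is uncovered and one of the counters is small. -/
def selectBody : Prog :=
  .seq (.ite (.and (.nle (.read 5 (nreg 6)) (.const 0))
      (.not (.and (.not (.nle (nreg 8) (.add (nreg 4) (.const 1))))
        (.not (.nle (nreg 9) (.add (nreg 4) (.const 1)))))))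
    (.seq (.setNat 3 (nreg 6) (.const 1)) (incr 10)) .skip) <|
  incr 6

def selectProg : Prog :=
  .seq (.setNat 6 (.const 0) (.const 0)) <|
  .while (.not (.nle (nreg 0) (nreg 6))) <|
    .seq (.seq (.setNat 7 (.const 0) (.const 0)) <|
      .seq (.setNat 8 (.const 0) (.const 0)) (.setNat 9 (.const 0) (.const 0))) <|
    .seq (.while (.not (.nle (nreg 0) (nreg 7))) countBody)
    selectBody

def clearBody : Prog := .seq (.setNat 3 (nreg 6) (.const 0)) (incr 6)

/-- Return the empty set if too many vertices have been selected. -/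
def clearProg : Prog :=
  .ite (.nle (nreg 10) (.add (nreg 4) (.add (nreg 4) (.add (nreg 4) (.const 5))))) .skip <|
  .seq (.setNat 6 (.const 0) (.const 0)) <|
  .while (.not (.nle (nreg 0) (nreg 6))) clearBody

/-- Use of the memory: among the naturals, `4` holds the parameter, array `5` the flags of covered
vertices, `6` and `7` the loop indices, `8` and `9` the two counters, `10` the number of selected
vertices, array `3` the output. Among the reals, `2` holds the current quotient and `3` to `5` are
scratch. -/
def rootProg : Prog := .seq paramProg (.seq coverProg (.seq selectProg clearProg))

/-! ### Correctness of the program -/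

structure ParamInv (E : Input) (k : ℕ) (s : State) : Prop extends E.In s where
  param : s.nats 4 0 = k
  quot : s.reals 2 0 = 8 ^ k / k.factorial
  out : s.nats 3 = 0
  flag : s.nats 5 = 0
  idx : s.nats 6 0 = 0
  total : s.nats 10 0 = 0

theorem runs_paramProg (E : Input) (K : ℕ) (hlt : ∀ k < K, E.ε < 8 ^ k / k.factorial)
    (hle : (8 : ℝ) ^ K / K.factorial ≤ E.ε) :
    Runs paramProg (100 * (K + 1))
      (fun s => E.In s ∧ s.nats 4 0 = 0 ∧ s.nats 3 = 0 ∧ s.nats 5 = 0 ∧ s.nats 6 0 = 0 ∧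
        s.nats 10 0 = 0)
      (ParamInv E K) := by
  refine Runs.mono (Runs.seq (B := ParamInv E 0)
    (Runs.of_loopFree (by simp [Prog.LoopFree]) ?_)
    (Runs.while (ParamInv E) K paramBody.maxCost (fun k s hk hs => ?_) (fun s hs => ?_)
      (fun k hk => Runs.of_loopFree (by simp [paramBody, incr, Prog.LoopFree]) fun s hs => ?_))) ?_
  · rintro s ⟨⟨h1, h2, h3, h4, h5⟩, h6, h7, h8, h9, h10⟩
    constructor
    · constructor <;> simpa [Prog.run, State.setReal]
    · simpa [Prog.run, State.setReal]
    · simp [Prog.run, State.setReal, RExpr.eval, NExpr.eval]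
    all_goals simpa [Prog.run, State.setReal, RExpr.eval, NExpr.eval]
  · simpa [Test.holds, hs.quot, hs.ε] using hlt k hk
  · simpa [Test.holds, hs.quot, hs.ε] using hle
  · obtain ⟨⟨h1, h2, h3, h4, h5⟩, h6, h7, h8, h9, h10, h11⟩ := hs
    constructor
    · constructor <;> simpa [paramBody, incr, Prog.run, State.setReal, State.setNat]
    · simp [paramBody, incr, Prog.run, State.setReal, State.setNat, NExpr.eval, h6]
    · simp [paramBody, incr, Prog.run, State.setReal, State.setNat, NExpr.eval, RExpr.eval, h6, h7,
        Nat.factorial_succ]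
      field_simp
      ring
    all_goals simpa [paramBody, incr, Prog.run, State.setReal, State.setNat]
  · simp [paramBody, incr, Prog.maxCost, Test.cost, NExpr.cost, RExpr.cost]
    omega

structure CoverInv (E : Input) (K i j : ℕ) (s : State) : Prop extends E.In s where
  param : s.nats 4 0 = K
  out : s.nats 3 = 0
  total : s.nats 10 0 = 0
  idx : s.nats 6 0 = i
  edge : s.nats 7 0 = j
  flag : ∀ l, s.nats 5 l ≠ 0 ↔ (l < i ∧ E.Covered l) ∨ (l = i ∧ ∃ j' < j, E.EdgeCovers i j')

theorem run_coverBody {E : Input} {K i j : ℕ} {s : State} (hs : CoverInv E K i j s) :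
    ∃ s' : State, (coverBody.run s) = s'.setNat 7 0 (j + 1) ∧ s'.nats 0 = s.nats 0 ∧
      s'.nats 1 = s.nats 1 ∧ s'.nats 2 = s.nats 2 ∧ s'.nats 3 = s.nats 3 ∧ s'.nats 4 = s.nats 4 ∧
      s'.nats 6 = s.nats 6 ∧ s'.nats 10 = s.nats 10 ∧ s'.reals 0 = s.reals 0 ∧
      s'.reals 1 = s.reals 1 ∧
      ∀ l, s'.nats 5 l ≠ 0 ↔ s.nats 5 l ≠ 0 ∨ (l = i ∧ E.EdgeCovers i j) := by
  obtain ⟨⟨h1, h2, h3, h4, h5⟩, h6, h7, h8, h9, h10, h11⟩ := hs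
  set S := ((s.setReal 3 0 (coordDist (E.pos i) (E.pos (E.e₁ j)))).setReal 4 0
      (coordDist (E.pos i) (E.pos (E.e₂ j)))).setReal 5 0
      (coordDist (E.pos (E.e₁ j)) (E.pos (E.e₂ j))) with hS
  have hS7 : S.nats 7 0 = j := h10
  have hS6 : S.nats 6 0 = i := h9
  by_cases hc : E.EdgeCovers i j
  · refine ⟨S.setNat 5 i 1, ?_, ?_⟩
    · simp [coverBody, incr, Prog.run, run_distProg, Test.holds, RExpr.eval, NExpr.eval,
        State.setReal, State.setNat, h9, h10, h2, h3, h4, hS, hc.1, hc.2]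
    · refine ⟨rfl, rfl, rfl, rfl, rfl, rfl, rfl, rfl, rfl, fun l => ?_⟩
      by_cases hl : l = i
      · simp [State.setNat, hl, hc]
      · simp [State.setNat, hl, hS, State.setReal]
  · refine ⟨S, ?_, ?_⟩
    · have hc' : ¬ (coordDist (E.pos i) (E.pos (E.e₁ j)) <
          coordDist (E.pos (E.e₁ j)) (E.pos (E.e₂ j)) ∧ coordDist (E.pos i) (E.pos (E.e₂ j)) <
          coordDist (E.pos (E.e₁ j)) (E.pos (E.e₂ j))) := hc
      simp [coverBody, incr, Prog.run, run_distProg, Test.holds, RExpr.eval, NExpr.eval,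
        State.setReal, State.setNat, h9, h10, h2, h3, h4, hS, -not_and, hc']
    · refine ⟨rfl, rfl, rfl, rfl, rfl, rfl, rfl, rfl, rfl, fun l => ?_⟩
      simp [hS, State.setReal, hc]

theorem coverBody_spec {E : Input} {K i j : ℕ} {s : State} (hs : CoverInv E K i j s) :
    CoverInv E K i (j + 1) (coverBody.run s) := by
  obtain ⟨s', hrun, a0, a1, a2, a3, a4, a6, a10, b0, b1, hf⟩ := run_coverBody hs
  obtain ⟨⟨h1, h2, h3, h4, h5⟩, h6, h7, h8, h9, h10, h11⟩ := hs
  rw [hrun]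
  refine ⟨⟨?_, ?_, ?_, ?_, ?_⟩, ?_, ?_, ?_, ?_, ?_, fun l => ?_⟩
  all_goals simp [State.setNat, *]
  rw [or_assoc]
  refine or_congr_right ?_
  constructor
  · rintro (⟨h, j', hj', hc⟩ | ⟨h, hc⟩)
    · exact ⟨h, j', by omega, hc⟩
    · exact ⟨h, j, by omega, hc⟩
  · rintro ⟨h, j', hj', hc⟩
    rcases hj'.lt_or_eq with h' | rfl
    · exact Or.inl ⟨h, j', h', hc⟩
    · exact Or.inr ⟨h, hc⟩

structure CoverDone (E : Input) (K : ℕ) (s : State) : Prop extends E.In s where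
  param : s.nats 4 0 = K
  out : s.nats 3 = 0
  total : s.nats 10 0 = 0
  flag : ∀ l, s.nats 5 l ≠ 0 ↔ l < E.n ∧ E.Covered l

theorem runs_coverProg (E : Input) (K : ℕ) :
    Runs coverProg (E.n * (400 * (E.n + 1)) + 400) (ParamInv E K) (CoverDone E K) := by
  set Inv : ℕ → State → Prop := fun i s => E.In s ∧ s.nats 4 0 = K ∧ s.nats 3 = 0 ∧
    s.nats 10 0 = 0 ∧ s.nats 6 0 = i ∧ ∀ l, s.nats 5 l ≠ 0 ↔ l < i ∧ E.Covered l with hInv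
  have h := Runs.while (b := .not (.nle (nreg 0) (nreg 6)))
    (P := .seq (.setNat 7 (.const 0) (.const 0)) <|
      .seq (.while (.nle (.add (nreg 7) (.const 2)) (nreg 0)) coverBody) <| incr 6)
    Inv E.n (300 * (E.n + 1)) ?_ ?_ ?_
  · refine Runs.mono (h.conseq (fun s hs => ?_) (fun s hs => ?_)) ?_
    · exact ⟨hs.toIn, hs.param, hs.out, hs.total, hs.idx, fun l => by simp [hs.flag]⟩
    · obtain ⟨h1, h2, h3, h4, h5, h6⟩ := hs
      exact ⟨h1, h2, h3, h4, h6⟩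
    · simp [Test.cost]
      nlinarith
  · rintro k s hk ⟨h1, -, -, -, h5, -⟩
    simpa [Test.holds, h1.n, h5] using hk
  · rintro s ⟨h1, -, -, -, h5, -⟩
    simp [Test.holds, h1.n, h5]
  · intro i hi
    refine Runs.mono (Runs.seq (B := CoverInv E K i 0) (Runs.of_loopFree (by simp [Prog.LoopFree]) ?_)
      (Runs.seq (B := CoverInv E K i (E.n - 1))
        (Runs.while (CoverInv E K i) (E.n - 1) coverBody.maxCost ?_ ?_
          (fun j hj => Runs.of_loopFree
            (by simp [coverBody, distProg, incr, Prog.LoopFree]) fun s hs => coverBody_spec hs))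
        (Runs.of_loopFree (P := incr 6) trivial (fun s hs => ?_)))) ?_
    · rintro s ⟨⟨h1, h2, h3, h4, h5⟩, h6, h7, h8, h9, h10⟩
      refine ⟨⟨?_, ?_, ?_, ?_, ?_⟩, ?_, ?_, ?_, ?_, ?_, fun l => ?_⟩ <;>
        simp [Prog.run, NExpr.eval, State.setNat, *]
    · rintro k s hk hs
      simp only [Test.holds, NExpr.eval, eval_nreg, hs.n, hs.edge]
      omega
    · rintro s hs
      simp only [Test.holds, NExpr.eval, eval_nreg, hs.n, hs.edge]
      omega
    · obtain ⟨⟨h1, h2, h3, h4, h5⟩, h6, h7, h8, h9, h10, h11⟩ := hs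
      refine ⟨⟨?_, ?_, ?_, ?_, ?_⟩, ?_, ?_, ?_, ?_, fun l => ?_⟩
      all_goals simp [incr, Prog.run, NExpr.eval, State.setNat, *]
      have e1 : (∃ j' < E.n - 1, E.EdgeCovers i j') ↔ E.Covered i :=
        ⟨fun ⟨j, h, h'⟩ => ⟨j, by omega, h'⟩, fun ⟨j, h, h'⟩ => ⟨j, by omega, h'⟩⟩
      rw [e1, le_iff_lt_or_eq, or_and_right]
      refine or_congr_right (and_congr_right ?_)
      rintro rfl; rfl
    · simp [coverBody, distProg, incr, Prog.maxCost, Test.cost, NExpr.cost, RExpr.cost]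
      omega

structure SelectInv (E : Input) (K i : ℕ) (s : State) : Prop extends E.In s where
  param : s.nats 4 0 = K
  flag : ∀ l, s.nats 5 l ≠ 0 ↔ l < E.n ∧ E.Covered l
  idx : s.nats 6 0 = i
  total : s.nats 10 0 = (E.sparse K i).card
  out : ∀ l, s.nats 3 l ≠ 0 ↔ l < i ∧ E.Sparse K l

structure CountInv (E : Input) (K i j : ℕ) (s : State) : Prop extends SelectInv E K i s where
  other : s.nats 7 0 = j
  cntAfter : s.nats 8 0 = (E.after i j).card
  cntBefore : s.nats 9 0 = (E.before i j).card

open Classical in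
theorem card_filter_range_succ (p : ℕ → Prop) (k : ℕ) :
    ((Finset.range (k + 1)).filter p).card =
      ((Finset.range k).filter p).card + if p k then 1 else 0 := by
  rw [Finset.range_add_one, Finset.filter_insert]
  split_ifs
  · rw [Finset.card_insert_of_notMem (by simp)]
  · simp

open Classical in
theorem Input.card_after_succ (E : Input) (i j : ℕ) : (E.after i (j + 1)).card =
    (E.after i j).card + if ¬ E.Covered j ∧ 0 < coordOffset (E.pos i) (E.pos j) ∧
      coordOffset (E.pos i) (E.pos j) ≤ 1 / 4 then 1 else 0 := by
  unfold Input.after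
  convert card_filter_range_succ _ j

open Classical in
theorem Input.card_before_succ (E : Input) (i j : ℕ) : (E.before i (j + 1)).card =
    (E.before i j).card + if ¬ E.Covered j ∧ 3 / 4 ≤ coordOffset (E.pos i) (E.pos j)
      then 1 else 0 := by
  unfold Input.before
  convert card_filter_range_succ _ j

open Classical in
theorem Input.card_sparse_succ (E : Input) (K i : ℕ) : (E.sparse K (i + 1)).card =
    (E.sparse K i).card + if E.Sparse K i then 1 else 0 := by
  unfold Input.sparse
  convert card_filter_range_succ _ i

open Classical in
theorem run_countBody {E : Input} {K i j : ℕ} {s : State} (hj : j < E.n)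
    (hs : CountInv E K i j s) :
    ∃ s' : State, countBody.run s = s'.setNat 7 0 (j + 1) ∧ s'.nats 0 = s.nats 0 ∧
      s'.nats 1 = s.nats 1 ∧ s'.nats 2 = s.nats 2 ∧ s'.nats 3 = s.nats 3 ∧ s'.nats 4 = s.nats 4 ∧
      s'.nats 5 = s.nats 5 ∧ s'.nats 6 = s.nats 6 ∧ s'.nats 10 = s.nats 10 ∧
      s'.reals 0 = s.reals 0 ∧ s'.reals 1 = s.reals 1 ∧
      s'.nats 8 0 = s.nats 8 0 + (if ¬ E.Covered j ∧ 0 < coordOffset (E.pos i) (E.pos j) ∧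
        coordOffset (E.pos i) (E.pos j) ≤ 1 / 4 then 1 else 0) ∧
      s'.nats 9 0 = s.nats 9 0 + (if ¬ E.Covered j ∧
        3 / 4 ≤ coordOffset (E.pos i) (E.pos j) then 1 else 0) := by
  obtain ⟨⟨⟨h1, h2, h3, h4, h5⟩, h6, h7, h8, h9, h10⟩, h11, h12, h13⟩ := hs
  have hf : s.nats 5 j = 0 ↔ ¬ E.Covered j := by
    rw [← not_iff_not, not_not]
    exact (h7 j).trans (and_iff_right hj)
  set S := s.setReal 3 0 (coordOffset (E.pos i) (E.pos j)) with hS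
  by_cases hc : E.Covered j
  · refine ⟨S, ?_, rfl, rfl, rfl, rfl, rfl, rfl, rfl, rfl, rfl, rfl, ?_⟩
    · simp [countBody, incr, Prog.run, run_offsetProg, Test.holds, RExpr.eval, NExpr.eval,
        State.setReal, State.setNat, h4, h8, h11, hS, hf, hc]
    · simp [hS, State.setReal, hc]
  by_cases ha : 0 < coordOffset (E.pos i) (E.pos j) ∧ coordOffset (E.pos i) (E.pos j) ≤ 1 / 4
  · have hb : ¬ 3 / 4 ≤ coordOffset (E.pos i) (E.pos j) := by linarith [ha.2]
    refine ⟨S.setNat 8 0 (s.nats 8 0 + 1), ?_, rfl, rfl, rfl, rfl, rfl, rfl, rfl, rfl, rfl, rfl, ?_⟩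
    · simp [countBody, incr, Prog.run, run_offsetProg, Test.holds, RExpr.eval, NExpr.eval,
        State.setReal, State.setNat, h4, h8, h11, hS, hf, hc, ha.1, ha.2, hb, -one_div]
    · simp [State.setNat, hS, State.setReal, hc, ha.1, ha.2, hb, -one_div]
  by_cases hb : 3 / 4 ≤ coordOffset (E.pos i) (E.pos j)
  · refine ⟨S.setNat 9 0 (s.nats 9 0 + 1), ?_, rfl, rfl, rfl, rfl, rfl, rfl, rfl, rfl, rfl, rfl, ?_⟩
    · simp [countBody, incr, Prog.run, run_offsetProg, Test.holds, RExpr.eval, NExpr.eval,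
        State.setReal, State.setNat, h4, h8, h11, hS, hf, hc, ha, hb, -one_div, -not_and]
    · simp [State.setNat, hS, State.setReal, hc, ha, hb, -one_div, -not_and]
  · refine ⟨S, ?_, rfl, rfl, rfl, rfl, rfl, rfl, rfl, rfl, rfl, rfl, ?_⟩
    · simp [countBody, incr, Prog.run, run_offsetProg, Test.holds, RExpr.eval, NExpr.eval,
        State.setReal, State.setNat, h4, h8, h11, hS, hf, hc, ha, hb, -one_div, -not_and]
    · simp [hS, State.setReal, hc, ha, hb, -one_div, -not_and]

theorem countBody_spec {E : Input} {K i j : ℕ} {s : State} (hj : j < E.n)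
    (hs : CountInv E K i j s) : CountInv E K i (j + 1) (countBody.run s) := by
  classical
  obtain ⟨s', hrun, a0, a1, a2, a3, a4, a5, a6, a10, b0, b1, c8, c9⟩ := run_countBody hj hs
  obtain ⟨⟨⟨h1, h2, h3, h4, h5⟩, h6, h7, h8, h9, h10⟩, h11, h12, h13⟩ := hs
  rw [hrun]
  rw [h12] at c8
  rw [h13] at c9
  have ea := E.card_after_succ i j
  have eb := E.card_before_succ i j
  refine ⟨⟨⟨?_, ?_, ?_, ?_, ?_⟩, ?_, fun l => ?_, ?_, ?_, fun l => ?_⟩, ?_, ?_, ?_⟩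
  · simpa [State.setNat, a0] using h1
  · simpa [State.setNat, a1] using h2
  · simpa [State.setNat, a2] using h3
  · simpa [State.setNat, b1] using h4
  · simpa [State.setNat, b0] using h5
  · simpa [State.setNat, a4] using h6
  · simpa [State.setNat, a5] using h7 l
  · simpa [State.setNat, a6] using h8
  · simpa [State.setNat, a10] using h9
  · simpa [State.setNat, a3] using h10 l
  · simp [State.setNat]
  · rw [ea, ← c8]; simp [State.setNat]
  · rw [eb, ← c9]; simp [State.setNat]

theorem selectBody_spec {E : Input} {K i : ℕ} {s : State} (hi : i < E.n)
    (hs : CountInv E K i E.n s) : SelectInv E K (i + 1) (selectBody.run s) := by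
  classical
  obtain ⟨⟨⟨h1, h2, h3, h4, h5⟩, h6, h7, h8, h9, h10⟩, h11, h12, h13⟩ := hs
  have hf : s.nats 5 i = 0 ↔ ¬ E.Covered i := by
    rw [← not_iff_not, not_not]
    exact (h7 i).trans (and_iff_right hi)
  have es := E.card_sparse_succ K i
  have hrun : ∃ s' : State, selectBody.run s = s'.setNat 6 0 (i + 1) ∧ s'.nats 0 = s.nats 0 ∧
      s'.nats 1 = s.nats 1 ∧ s'.nats 2 = s.nats 2 ∧ s'.nats 4 = s.nats 4 ∧
      s'.nats 5 = s.nats 5 ∧ s'.reals = s.reals ∧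
      s'.nats 10 0 = (E.sparse K (i + 1)).card ∧
      ∀ l, s'.nats 3 l ≠ 0 ↔ s.nats 3 l ≠ 0 ∨ (l = i ∧ E.Sparse K i) := by
    -- Tests have no disjunction, so the program uses De Morgan's law.
    have hiff : (s.nats 5 i ≤ 0 ∧
        ¬ (¬ (s.nats 8 0 ≤ s.nats 4 0 + 1) ∧ ¬ (s.nats 9 0 ≤ s.nats 4 0 + 1))) ↔
        E.Sparse K i := by
      rw [Nat.le_zero, hf, h6, h12, h13]
      unfold Input.Sparse
      tauto
    by_cases hc : E.Sparse K i
    · rw [if_pos hc] at es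
      refine ⟨(s.setNat 3 i 1).setNat 10 0 (s.nats 10 0 + 1), ?_, rfl, rfl, rfl, rfl, rfl, rfl,
        ?_, fun l => ?_⟩
      · rw [selectBody, Prog.run, Prog.run, if_pos (by
          simp only [Test.holds, NExpr.eval, eval_nreg, h8]; exact hiff.2 hc)]
        simp [incr, Prog.run, NExpr.eval, State.setNat, h8]
      · simp [State.setNat, es, h9]
      · by_cases hl : l = i
        · simp [State.setNat, hl, hc]
        · simp [State.setNat, hl]
    · rw [if_neg hc] at es
      refine ⟨s, ?_, rfl, rfl, rfl, rfl, rfl, rfl, by rw [es, h9]; rfl, fun l => by simp [hc]⟩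
      rw [selectBody, Prog.run, Prog.run, if_neg (by
        simp only [Test.holds, NExpr.eval, eval_nreg, h8]; exact fun h => hc (hiff.1 h))]
      simp [incr, Prog.run, NExpr.eval, State.setNat, h8]
  obtain ⟨s', hrun, a0, a1, a2, a4, a5, b, a10, a3⟩ := hrun
  rw [hrun]
  refine ⟨⟨?_, ?_, ?_, ?_, ?_⟩, ?_, fun l => ?_, ?_, ?_, fun l => ?_⟩
  · simpa [State.setNat, a0] using h1
  · simpa [State.setNat, a1] using h2
  · simpa [State.setNat, a2] using h3
  · simpa [State.setNat, b] using h4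
  · simpa [State.setNat, b] using h5
  · simpa [State.setNat, a4] using h6
  · simpa [State.setNat, a5] using h7 l
  · simp [State.setNat]
  · simpa [State.setNat] using a10
  · have : (s'.setNat 6 0 (i + 1)).nats 3 = s'.nats 3 := rfl
    rw [this, a3, h10, Nat.lt_succ_iff, le_iff_lt_or_eq, or_and_right]
    refine or_congr_right (and_congr_right ?_)
    rintro rfl; rfl

theorem runs_selectProg (E : Input) (K : ℕ) :
    Runs selectProg (E.n * (400 * (E.n + 1)) + 400) (CoverDone E K) (SelectInv E K E.n) := by
  have hw := Runs.while (b := .not (.nle (nreg 0) (nreg 6)))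
    (P := .seq (.seq (.setNat 7 (.const 0) (.const 0)) <|
      .seq (.setNat 8 (.const 0) (.const 0)) (.setNat 9 (.const 0) (.const 0))) <|
      .seq (.while (.not (.nle (nreg 0) (nreg 7))) countBody) selectBody)
    (SelectInv E K) E.n (300 * (E.n + 1)) ?_ ?_ ?_
  · refine Runs.mono (Runs.seq (B := SelectInv E K 0)
      (Runs.of_loopFree (by simp [Prog.LoopFree]) ?_) hw) ?_
    · rintro s ⟨⟨h1, h2, h3, h4, h5⟩, h6, h7, h8, h9⟩
      refine ⟨⟨?_, ?_, ?_, ?_, ?_⟩, ?_, fun l => ?_, ?_, ?_, fun l => ?_⟩ <;>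
        simp [Prog.run, NExpr.eval, State.setNat, Input.sparse, *]
    · simp [Test.cost, Prog.maxCost, NExpr.cost]
      nlinarith
  · rintro k s hk hs
    simpa [Test.holds, hs.n, hs.idx] using hk
  · rintro s hs
    simp [Test.holds, hs.n, hs.idx]
  · intro i hi
    refine Runs.mono (Runs.seq (B := CountInv E K i 0)
      (Runs.of_loopFree (by simp [Prog.LoopFree]) ?_)
      (Runs.seq (B := CountInv E K i E.n)
        (Runs.while (CountInv E K i) E.n countBody.maxCost ?_ ?_
          (fun j hj => Runs.of_loopFree
            (by simp [countBody, offsetProg, incr, Prog.LoopFree])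
              fun s hs => countBody_spec hj hs))
        (Runs.of_loopFree (by simp [selectBody, incr, Prog.LoopFree])
          (fun s hs => selectBody_spec hi hs)))) ?_
    · rintro s ⟨⟨h1, h2, h3, h4, h5⟩, h6, h7, h8, h9, h10⟩
      refine ⟨⟨⟨?_, ?_, ?_, ?_, ?_⟩, ?_, fun l => ?_, ?_, ?_, fun l => ?_⟩, ?_, ?_, ?_⟩
      · simpa [Prog.run, State.setNat] using h1
      · simpa [Prog.run, State.setNat] using h2
      · simpa [Prog.run, State.setNat] using h3
      · simpa [Prog.run, State.setNat] using h4
      · simpa [Prog.run, State.setNat] using h5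
      · simpa [Prog.run, State.setNat] using h6
      · simpa [Prog.run, State.setNat] using h7 l
      · simpa [Prog.run, State.setNat] using h8
      · simpa [Prog.run, State.setNat] using h9
      · simpa [Prog.run, State.setNat] using h10 l
      · simp [Prog.run, State.setNat, NExpr.eval]
      · simp [Prog.run, State.setNat, NExpr.eval, Input.after]
      · simp [Prog.run, State.setNat, NExpr.eval, Input.before]
    · rintro k s hk hs
      simpa [Test.holds, hs.n, hs.other] using hk
    · rintro s hs
      simp [Test.holds, hs.n, hs.other]
    · simp [countBody, selectBody, offsetProg, incr, Prog.maxCost, Test.cost, NExpr.cost,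
        RExpr.cost]
      omega

theorem runs_clearProg (E : Input) (K : ℕ) :
    Runs clearProg (200 * (E.n + 1)) (SelectInv E K E.n)
      (fun s => ∀ l, l < E.n →
        (s.nats 3 l ≠ 0 ↔ E.Sparse K l ∧ (E.sparse K E.n).card ≤ 3 * K + 5)) := by
  set Inv : ℕ → State → Prop := fun i s => s.nats 0 0 = E.n ∧ s.nats 6 0 = i ∧
    (∀ l < i, s.nats 3 l = 0) ∧ ¬ (E.sparse K E.n).card ≤ 3 * K + 5 with hInv
  refine Runs.mono (Runs.ite (c := 90 * (E.n + 1)) (Runs.mono (Runs.of_loopFree (P := .skip) (by simp [Prog.LoopFree]) ?_) ?_)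
    (Runs.mono (Runs.seq (B := Inv 0) (Runs.of_loopFree (by simp [Prog.LoopFree]) ?_)
      (Runs.conseq (Runs.while Inv E.n clearBody.maxCost ?_ ?_
        (fun i hi => Runs.of_loopFree (by simp [clearBody, incr, Prog.LoopFree]) ?_))
        (fun s hs => hs) ?_)) ?_)) ?_
  · rintro s ⟨hs, hb⟩ l hl
    simp only [Test.holds, NExpr.eval, eval_nreg, hs.total, hs.param] at hb
    rw [Prog.run, hs.out]
    exact ⟨fun h => ⟨h.2, by omega⟩, fun h => ⟨hl, h.1⟩⟩
  · simp [Prog.maxCost]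
    omega
  · rintro s ⟨hs, hb⟩
    simp only [Test.holds, NExpr.eval, eval_nreg, hs.total, hs.param] at hb
    refine ⟨?_, ?_, by simp, by omega⟩
    · simpa [Prog.run, State.setNat] using hs.n
    · simp [Prog.run, State.setNat, NExpr.eval]
  · rintro k s hk ⟨h1, h2, -⟩
    simpa [Test.holds, h1, h2] using hk
  · rintro s ⟨h1, h2, -⟩
    simp [Test.holds, h1, h2]
  · rintro s ⟨h1, h2, h3, h4⟩
    refine ⟨?_, ?_, fun l hl => ?_, h4⟩
    · simpa [clearBody, incr, Prog.run, State.setNat] using h1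
    · simp [clearBody, incr, Prog.run, State.setNat, NExpr.eval, h2]
    · by_cases hli : l = i
      · simp [clearBody, incr, Prog.run, State.setNat, NExpr.eval, h2, hli]
      · simpa [clearBody, incr, Prog.run, State.setNat, NExpr.eval, h2, hli] using h3 l (by omega)
  · rintro s ⟨h1, h2, h3, h4⟩ l hl
    simp [h3 l hl, h4]
  · simp [clearBody, incr, Prog.maxCost, Test.cost, NExpr.cost]
    omega
  · simp [Test.cost, NExpr.cost]
    omega

theorem runs_rootProg (E : Input) (K : ℕ) (hlt : ∀ k < K, E.ε < 8 ^ k / k.factorial)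
    (hle : (8 : ℝ) ^ K / K.factorial ≤ E.ε) :
    Runs rootProg (100 * (K + 1) + 1000 * (E.n + 1) ^ 2)
      (fun s => E.In s ∧ s.nats 4 0 = 0 ∧ s.nats 3 = 0 ∧ s.nats 5 = 0 ∧ s.nats 6 0 = 0 ∧
        s.nats 10 0 = 0)
      (fun s => ∀ l, l < E.n →
        (s.nats 3 l ≠ 0 ↔ E.Sparse K l ∧ (E.sparse K E.n).card ≤ 3 * K + 5)) := by
  refine Runs.mono ((runs_paramProg E K hlt hle).seq ((runs_coverProg E K).seq
    ((runs_selectProg E K).seq (runs_clearProg E K)))) ?_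
  have e1 : (E.n + 1) ^ 2 = E.n * E.n + 2 * E.n + 1 := by ring
  have e2 : E.n * (400 * (E.n + 1)) = 400 * (E.n * E.n) + 400 * E.n := by ring
  rw [e1, e2]
  omega

/-! ### The program computes the confidence set -/

/-- The input of the program given by a presentation. -/
noncomputable def presInput {n : ℕ} (ε : ℝ) (v : Fin n → UnitAddCircle)
    (e : Fin (n - 1) → Fin n × Fin n) : Input where
  n := n
  e₁ := (initState ε v e).nats 1
  e₂ := (initState ε v e).nats 2
  pos := (initState ε v e).reals 1
  ε := ε

theorem presInput_in {n : ℕ} (ε : ℝ) (v : Fin n → UnitAddCircle)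
    (e : Fin (n - 1) → Fin n × Fin n) : (presInput ε v e).In (initState ε v e) :=
  ⟨rfl, rfl, rfl, rfl, rfl⟩

theorem coordDist_offset (a b : UnitAddCircle) :
    coordDist (offset 0 a) (offset 0 b) = dist a b := (dist_eq_min_abs 0 a b).symm

theorem coordOffset_offset (a b : UnitAddCircle) :
    coordOffset (offset 0 a) (offset 0 b) = offset a b := by
  unfold coordOffset
  split_ifs with h
  · exact (offset_of_le (by linarith)).symm
  · exact (offset_of_lt (by linarith)).symm

section Presentation

variable {n : ℕ} {ε : ℝ} {T : EmbTree} {v : Fin n → UnitAddCircle}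
  {e : Fin (n - 1) → Fin n × Fin n}

theorem presInput_pos (i : Fin n) : (presInput ε v e).pos i = offset 0 (v i) := by
  simp [presInput, initState, offset]

theorem presInput_e₁ (j : Fin (n - 1)) : (presInput ε v e).e₁ j = (e j).1 := by
  simp [presInput, initState]

theorem presInput_e₂ (j : Fin (n - 1)) : (presInput ε v e).e₂ j = (e j).2 := by
  simp [presInput, initState]

theorem presInput_covered (h : IsPresentation T v e) (i : Fin n) :
    (presInput ε v e).Covered i ↔ Covered T (v i) := by
  classical
  obtain ⟨-, -, -, he⟩ := h
  have key : ∀ j : Fin (n - 1), (presInput ε v e).EdgeCovers i j ↔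
      dist (v i) (v (e j).1) < dist (v (e j).1) (v (e j).2) ∧
      dist (v i) (v (e j).2) < dist (v (e j).1) (v (e j).2) := by
    intro j
    simp only [Input.EdgeCovers, presInput_e₁, presInput_e₂, presInput_pos, coordDist_offset]
  constructor
  · rintro ⟨j, hj, hc⟩
    change j + 2 ≤ n at hj
    have hc := (key ⟨j, by omega⟩).1 hc
    refine ⟨_, _, ?_, hc.1, hc.2⟩
    rw [← he]
    exact Finset.mem_image_of_mem _ (Finset.mem_univ _)
  · rintro ⟨u, w, huw, h1, h2⟩
    rw [← he] at huw
    obtain ⟨j, -, hj⟩ := Finset.mem_image.1 huw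
    refine ⟨j, by have := j.isLt; change j.val + 2 ≤ n; omega, (key j).2 ?_⟩
    -- The list may orient the edge either way; covering is symmetric in the endpoints.
    rcases Sym2.eq_iff.1 hj with ⟨rfl, rfl⟩ | ⟨rfl, rfl⟩
    · exact ⟨h1, h2⟩
    · rw [dist_comm (v (e j).1) (v (e j).2)]
      exact ⟨h2, h1⟩

/-- A presentation is a bijection from indices to vertices, so the counts made by the program are
counts of vertices. -/
theorem card_eq_of_presentation (h : IsPresentation T v e) (S : Finset ℕ)
    (S' : Finset UnitAddCircle) (hS : ∀ i ∈ S, i < n) (hS' : S' ⊆ T.verts)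
    (hSS' : ∀ i : Fin n, i.val ∈ S ↔ v i ∈ S') : S.card = S'.card := by
  classical
  obtain ⟨hinj, hv, -, -⟩ := h
  refine Finset.card_bij (fun i hi => v ⟨i, hS i hi⟩) (fun i hi => (hSS' ⟨i, hS i hi⟩).1 hi)
    (fun i hi j hj hij => by simpa using hinj hij) fun b hb => ?_
  have hb' := hS' hb
  rw [← hv] at hb'
  obtain ⟨i, -, rfl⟩ := Finset.mem_image.1 hb'
  exact ⟨i, (hSS' i).2 hb, rfl⟩

theorem mem_hull_presentation (h : IsPresentation T v e) (i : Fin n) :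
    v i ∈ hull T ↔ ¬ (presInput ε v e).Covered i := by
  classical
  rw [mem_hull, presInput_covered h, and_iff_right]
  rw [← h.2.1]
  exact Finset.mem_image_of_mem _ (Finset.mem_univ _)

theorem presInput_sparse (K : ℕ) (h : IsPresentation T v e) (i : Fin n) :
    (presInput ε v e).Sparse K i ↔ v i ∈ sparseHull K T := by
  classical
  have hsub : hull T ⊆ T.verts := Finset.filter_subset _ _
  have h1 : ((presInput ε v e).after i n).card = (hullAfter T (v i)).card := by
    refine card_eq_of_presentation h _ _
      (fun j hj => Finset.mem_range.1 (Finset.mem_filter.1 hj).1)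
      ((Finset.filter_subset _ _).trans hsub) fun j => ?_
    rw [Input.after, hullAfter, Finset.mem_filter, Finset.mem_filter,
      mem_hull_presentation (ε := ε) h, presInput_pos, presInput_pos, coordOffset_offset,
      Finset.mem_range, and_iff_right j.isLt]
  have h2 : ((presInput ε v e).before i n).card = (hullBefore T (v i)).card := by
    refine card_eq_of_presentation h _ _
      (fun j hj => Finset.mem_range.1 (Finset.mem_filter.1 hj).1)
      ((Finset.filter_subset _ _).trans hsub) fun j => ?_
    rw [Input.before, hullBefore, Finset.mem_filter, Finset.mem_filter,
      mem_hull_presentation (ε := ε) h, presInput_pos, presInput_pos, coordOffset_offset,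
      Finset.mem_range, and_iff_right j.isLt]
  rw [Input.Sparse, sparseHull, Finset.mem_filter, mem_hull_presentation (ε := ε) h]
  change _ ∧ (((presInput ε v e).after i n).card ≤ _ ∨
    ((presInput ε v e).before i n).card ≤ _) ↔ _
  rw [h1, h2]

theorem presInput_card_sparse (K : ℕ) (h : IsPresentation T v e) :
    ((presInput ε v e).sparse K n).card = (sparseHull K T).card := by
  classical
  refine card_eq_of_presentation h _ _
    (fun j hj => Finset.mem_range.1 (Finset.mem_filter.1 hj).1)
    ((Finset.filter_subset _ _).trans (Finset.filter_subset _ _)) fun j => ?_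
  rw [← presInput_sparse (ε := ε) K h, Input.sparse, Finset.mem_filter, Finset.mem_range,
    and_iff_right j.isLt]

end Presentation

theorem returnsWithin_rootProg {K : ℕ} {ε B : ℝ} (hlt : ∀ k < K, ε < 8 ^ k / k.factorial)
    (hle : (8 : ℝ) ^ K / K.factorial ≤ ε) (T : EmbTree)
    (hB : (100 * (K + 1) + 1000 * (T.verts.card + 1) ^ 2 : ℝ) ≤ B) :
    ReturnsWithin rootProg ε T (confSet K T) B := by
  classical
  refine ⟨confSet_subset K T, fun n v e h => ?_⟩
  have hn : T.verts.card = n := by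
    rw [← h.2.1, Finset.card_image_of_injective _ h.1, Finset.card_univ, Fintype.card_fin]
  obtain ⟨s, t, h1, h2, h3⟩ := runs_rootProg (presInput ε v e) K hlt hle (initState ε v e)
    ⟨presInput_in ε v e, rfl, rfl, rfl, rfl, rfl⟩
  refine ⟨s, t, h1, le_trans ?_ hB, fun i => ?_⟩
  · rw [hn]
    have : t ≤ 100 * (K + 1) + 1000 * (n + 1) ^ 2 := h2
    exact_mod_cast this
  · rw [h3 i i.isLt, presInput_sparse K h]
    change _ ∧ ((presInput ε v e).sparse K n).card ≤ _ ↔ _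
    rw [presInput_card_sparse K h, confSet]
    split_ifs with hc <;> simp [hc]

/-! ### Sizes -/

/-- On the naturals the dip of `x log x` between `0` and `1` is invisible. -/
theorem natCast_mul_log_mono {a b : ℕ} (h : a ≤ b) :
    (a : ℝ) * Real.log a ≤ b * Real.log b := by
  rcases Nat.eq_zero_or_pos a with rfl | ha
  · simpa using mul_nonneg (Nat.cast_nonneg b) (Real.log_natCast_nonneg b)
  · have ha' : (0 : ℝ) < a := by exact_mod_cast ha
    have hab : (a : ℝ) ≤ b := by exact_mod_cast h
    exact mul_le_mul hab (Real.log_le_log ha' hab) (Real.log_natCast_nonneg a) (by positivity)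

/-- The parameter of the confidence set for the error parameter `ε`. -/
noncomputable def confParam (ε : ℝ) : ℕ := sInf {K : ℕ | (8 : ℝ) ^ K / K.factorial ≤ ε}

theorem confParam_le {ε : ℝ} (hε : 0 < ε) :
    (8 : ℝ) ^ confParam ε / (confParam ε).factorial ≤ ε := by
  have h : {K : ℕ | (8 : ℝ) ^ K / K.factorial ≤ ε}.Nonempty := by
    have := (FloorSemiring.tendsto_pow_div_factorial_atTop (8 : ℝ)).eventually_le_const hε
    exact this.exists
  exact Nat.sInf_mem h

theorem lt_of_lt_confParam {ε : ℝ} {k : ℕ} (h : k < confParam ε) :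
    ε < (8 : ℝ) ^ k / k.factorial := by
  have := Nat.notMem_of_lt_sInf h
  exact not_le.1 this

/-- By minimality `N = K - 1` fails, so `ε < 8 ^ N / N! ≤ (8 e / N) ^ N`, that is `N log N < log (1
/ ε) + N (log 8 + 1)`. For large `N` the last term is at most half of `N log N`, whence `N log N ≤ 2
log (1 / ε)`. Bounded `N` is absorbed in the constants, as `log (1 / ε) > 200`. -/
theorem confParam_bounds {ε : ℝ} (hε : 0 < ε) (hε' : ε < Real.exp (-200)) :
    (confParam ε : ℝ) ≤ 4000 * Real.log (1 / ε) ∧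
    ((3 * confParam ε + 5 : ℕ) : ℝ) * Real.log ((3 * confParam ε + 5 : ℕ) : ℝ) ≤
      10 ^ 8 * Real.log (1 / ε) := by
  set L := Real.log (1 / ε) with hL
  have hlogε : Real.log ε = -L := by rw [hL, one_div, Real.log_inv]; ring
  have hL200 : 200 < L := by
    have := Real.log_lt_log hε hε'
    rw [Real.log_exp] at this
    linarith
  rcases Nat.eq_zero_or_pos (confParam ε) with h0 | hpos
  · rw [h0]
    refine ⟨by simp; linarith, ?_⟩
    have : Real.log ((3 * 0 + 5 : ℕ) : ℝ) ≤ ((3 * 0 + 5 : ℕ) : ℝ) - 1 :=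
      Real.log_le_sub_one_of_pos (by norm_num)
    norm_num at this ⊢
    linarith
  obtain ⟨N, hN⟩ := Nat.exists_eq_succ_of_ne_zero hpos.ne'
  rw [hN]
  rcases lt_or_ge N 3000 with hN3 | hN3
  · have hN3' : (N : ℝ) ≤ 3000 := by exact_mod_cast hN3.le
    refine ⟨by push_cast; linarith, ?_⟩
    have h1 := natCast_mul_log_mono (show 3 * N.succ + 5 ≤ 9008 by omega)
    have h2 : Real.log ((9008 : ℕ) : ℝ) ≤ ((9008 : ℕ) : ℝ) - 1 :=
      Real.log_le_sub_one_of_pos (by norm_num)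
    norm_num at h2 h1 ⊢
    linarith
  · have hN3' : (3000 : ℝ) ≤ N := by exact_mod_cast hN3
    have hN0 : (0 : ℝ) < N := by linarith
    have hlt : ε < (8 : ℝ) ^ N / N.factorial := lt_of_lt_confParam (by omega)
    have hfac := Real.pow_div_factorial_le_exp (N : ℝ) hN0.le N
    have hf0 : (0 : ℝ) < N.factorial := by exact_mod_cast N.factorial_pos
    have h1 : ε * (N : ℝ) ^ N < 8 ^ N * Real.exp N := by
      calc ε * (N : ℝ) ^ N < 8 ^ N / N.factorial * (N : ℝ) ^ N := by gcongr
        _ = 8 ^ N * ((N : ℝ) ^ N / N.factorial) := by ring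
        _ ≤ 8 ^ N * Real.exp N := by gcongr
    have h2 := Real.log_lt_log (by positivity) h1
    rw [Real.log_mul hε.ne' (by positivity), Real.log_mul (by positivity) (by positivity),
      Real.log_exp, Real.log_pow, Real.log_pow, hlogε] at h2
    have h3 : 2 * Real.log 8 + 2 ≤ Real.log N := by
      have he : Real.exp 2 ≤ 9 := by
        rw [show (2 : ℝ) = 1 + 1 by norm_num, Real.exp_add]
        nlinarith [Real.exp_one_lt_d9, Real.exp_pos 1]
      have : Real.log (64 * Real.exp 2) ≤ Real.log N :=
        Real.log_le_log (by positivity) (by linarith)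
      rw [Real.log_mul (by norm_num) (by positivity), Real.log_exp,
        show (64 : ℝ) = 8 ^ 2 by norm_num, Real.log_pow] at this
      push_cast at this
      exact this
    have h8 : 0 < Real.log 8 := Real.log_pos (by norm_num)
    have h4 : N * Real.log N ≤ 2 * L := by
      have h5 : (N : ℝ) * (2 * Real.log 8 + 2) ≤ N * Real.log N :=
        mul_le_mul_of_nonneg_left h3 hN0.le
      linarith
    have h6 : (N : ℝ) * 1 ≤ N * Real.log N := mul_le_mul_of_nonneg_left (by linarith) hN0.le
    refine ⟨by push_cast; linarith, ?_⟩
    have h7 := natCast_mul_log_mono (show 3 * N.succ + 5 ≤ 4 * N by omega)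
    refine h7.trans ?_
    push_cast
    rw [Real.log_mul (by norm_num) hN0.ne']
    have h9 : Real.log 4 ≤ Real.log N := Real.log_le_log (by norm_num) (by linarith)
    have h10 : (N : ℝ) * Real.log 4 ≤ N * Real.log N := mul_le_mul_of_nonneg_left h9 hN0.le
    nlinarith

theorem confSet_small {ε : ℝ} (hε : 0 < ε) (hε' : ε < Real.exp (-200)) (T : EmbTree) :
    ((confSet (confParam ε) T).card : ℝ) * Real.log ((confSet (confParam ε) T).card : ℝ) ≤
      10 ^ 8 * Real.log (1 / ε) :=
  (natCast_mul_log_mono (card_confSet_le _ T)).trans (confParam_bounds hε hε').2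

theorem log_one_div_gt {ε : ℝ} (hε : 0 < ε) (hε' : ε < Real.exp (-200)) :
    200 < Real.log (1 / ε) := by
  have := Real.log_lt_log hε hε'
  rw [Real.log_exp] at this
  rw [one_div, Real.log_inv]
  linarith

/-- The size below which no procedure succeeds. -/
theorem exists_critical_size {ε : ℝ} (hε : 0 < ε) (hε' : ε < Real.exp (-200)) :
    ∃ (K : ℕ) (q : ℝ≥0∞), q < 1 - ENNReal.ofReal ε ∧ 0 < K ∧
      (∀ n : ℕ, 1 / 12 * Real.log (1 / ε) ≤ n * Real.log n → K ≤ n) ∧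
      (∀ h : ℕ, h * Real.log h < 1 / 12 * Real.log (1 / ε) → h < K) ∧
      ∀ (n : ℕ) [NeZero n] (H : Procedure), K ≤ n →
        (∀ x : Fin n → UnitAddCircle, (H (nnTree x)).card < K) → rootProb H n ≤ q := by
  set L := Real.log (1 / ε) with hL
  have hL200 : 200 < L := log_one_div_gt hε hε'
  set A := {K : ℕ | 1 / 12 * L ≤ K * Real.log K} with hA
  have hne : A.Nonempty := by
    obtain ⟨m, hm⟩ := exists_nat_ge (max (Real.exp 1) L)
    refine ⟨m, ?_⟩
    have h1 : Real.exp 1 ≤ m := (le_max_left _ _).trans hm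
    have h2 : L ≤ m := (le_max_right _ _).trans hm
    have h3 : 1 ≤ Real.log m := by
      rw [← Real.log_exp 1]; exact Real.log_le_log (Real.exp_pos 1) h1
    change 1 / 12 * L ≤ m * Real.log m
    nlinarith
  set K := sInf A with hK
  have hKA : 1 / 12 * L ≤ K * Real.log K := Nat.sInf_mem hne
  have hmin : ∀ k < K, k * Real.log k < 1 / 12 * L := fun k hk =>
    not_le.1 (Nat.notMem_of_lt_sInf hk)
  have hKpos : 0 < K := by
    rcases Nat.eq_zero_or_pos K with h | h
    · rw [h] at hKA; norm_num at hKA; linarith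
    · exact h
  have hK0 : (0 : ℝ) < K := by exact_mod_cast hKpos
  have hK1 : (1 : ℝ) ≤ K := by exact_mod_cast hKpos
  set δ : ℝ := (1 / (16 * K)) ^ K / K with hδ
  have hδ0 : 0 < δ := by positivity
  -- Needed: `K log 16 + (K + 1) log K < L`. For `K ≥ 17` the left side is at most `3 K log K`. With
  -- `M = K - 1`, `K ≤ 2 M` and `K ≤ M ^ 2` give `K log K ≤ 4 M log M`, and `M log M < L / 12` by
  -- minimality; this is the origin of `1 / 12`. For `K ≤ 16` the left side is at most `99 < 200 <
  -- L`.
  have hεδ : ε < δ := by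
    rw [← Real.log_lt_log_iff hε hδ0]
    have e1 : Real.log ε = -L := by rw [hL, one_div, Real.log_inv]; ring
    have e2 : Real.log δ = -(K * (Real.log 16 + Real.log K) + Real.log K) := by
      rw [hδ, Real.log_div (by positivity) hK0.ne', Real.log_pow, one_div, Real.log_inv,
        Real.log_mul (by norm_num) hK0.ne']
      ring
    rw [e1, e2, neg_lt_neg_iff]
    have h16 : Real.log 16 < 3 := by
      rw [show (16 : ℝ) = 2 ^ 4 by norm_num, Real.log_pow]
      have := Real.log_two_lt_d9
      push_cast
      linarith
    have hlogK : 0 ≤ Real.log K := Real.log_nonneg hK1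
    rcases lt_or_ge K 17 with h17 | h17
    · have hK16 : (K : ℝ) ≤ 16 := by exact_mod_cast Nat.lt_succ_iff.1 h17
      have hl : Real.log K ≤ 3 := (Real.log_le_log hK0 hK16).trans h16.le
      nlinarith
    · obtain ⟨M, hM⟩ := Nat.exists_eq_succ_of_ne_zero hKpos.ne'
      have hM16 : (16 : ℝ) ≤ M := by
        have : 16 ≤ M := by omega
        exact_mod_cast this
      have hKM : (K : ℝ) = M + 1 := by rw [hM]; push_cast; ring
      have h1 : Real.log 16 ≤ Real.log K := Real.log_le_log (by norm_num) (by linarith)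
      have h2 : Real.log K ≤ 2 * Real.log M := by
        have : Real.log K ≤ Real.log ((M : ℝ) ^ 2) :=
          Real.log_le_log hK0 (by rw [hKM]; nlinarith)
        rwa [Real.log_pow] at this
      have h3 := hmin M (by omega)
      have h4 : K * Real.log 16 ≤ K * Real.log K := mul_le_mul_of_nonneg_left h1 hK0.le
      have h5 : 1 * Real.log K ≤ K * Real.log K := mul_le_mul_of_nonneg_right hK1 hlogK
      have h6 : K * Real.log K ≤ (2 * M) * (2 * Real.log M) :=
        mul_le_mul (by linarith) h2 hlogK (by linarith)
      nlinarith
  have hδ1 : δ ≤ 1 := by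
    refine div_le_one_of_le₀ (le_trans (pow_le_one₀ (by positivity) ?_) hK1) hK0.le
    rw [div_le_one (by positivity)]
    linarith
  refine ⟨K, 1 - ENNReal.ofReal δ, ?_, hKpos, fun n hn => Nat.sInf_le hn, fun h hh => ?_,
    fun n _ H hKn hH => rootProb_le hKpos hKn H hH⟩
  · rw [← ENNReal.ofReal_one, ← ENNReal.ofReal_sub _ hδ0.le, ← ENNReal.ofReal_sub _ hε.le]
    exact (ENNReal.ofReal_lt_ofReal_iff (by linarith)).2 (by linarith)
  · by_contra hc
    exact absurd (hKA.trans (natCast_mul_log_mono (not_lt.1 hc))) (not_le.2 hh)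

/-- The bound `q` does not depend on the procedure, so it survives averaging over the seed. -/
theorem lintegral_rootProb_lt {ε : ℝ} (hε : 0 < ε) (hε' : ε < Real.exp (-200)) {Ω : Type}
    [MeasurableSpace Ω] (ν : Measure Ω) [IsProbabilityMeasure ν] (H : Ω → Procedure) (n : ℕ)
    [NeZero n] (hn : 1 / 12 * Real.log (1 / ε) ≤ n * Real.log n)
    (hH : ∀ (ω : Ω) (x : Fin n → UnitAddCircle), ((H ω (nnTree x)).card : ℝ) *
      Real.log ((H ω (nnTree x)).card : ℝ) < 1 / 12 * Real.log (1 / ε)) :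
    ∫⁻ ω, rootProb (H ω) n ∂ν < 1 - ENNReal.ofReal ε := by
  obtain ⟨K, q, hq, -, h1, h2, h3⟩ := exists_critical_size hε hε'
  refine lt_of_le_of_lt ?_ hq
  calc ∫⁻ ω, rootProb (H ω) n ∂ν ≤ ∫⁻ _, q ∂ν :=
        lintegral_mono fun ω => h3 n (H ω) (h1 n hn) fun x => h2 _ (hH ω x)
    _ = q := by simp

/-- The bound `q` does not depend on `n` either, so the inequality stays strict in the limit. -/
theorem liminf_lintegral_rootProb_lt {ε : ℝ} (hε : 0 < ε) (hε' : ε < Real.exp (-200)) {Ω : Type}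
    [MeasurableSpace Ω] (ν : Measure Ω) [IsProbabilityMeasure ν] (H : Ω → Procedure)
    (hH : ∀ (ω : Ω) (n : ℕ) (x : Fin n → UnitAddCircle), ((H ω (nnTree x)).card : ℝ) *
      Real.log ((H ω (nnTree x)).card : ℝ) < 1 / 12 * Real.log (1 / ε)) :
    liminf (fun n : ℕ => ∫⁻ ω, rootProb (H ω) (n + 1) ∂ν) atTop < 1 - ENNReal.ofReal ε := by
  obtain ⟨K, q, hq, -, h1, h2, h3⟩ := exists_critical_size hε hε'
  refine lt_of_le_of_lt ?_ hq
  refine liminf_le_of_frequently_le' (Eventually.frequently ?_)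
  filter_upwards [eventually_ge_atTop K] with n hn
  calc ∫⁻ ω, rootProb (H ω) (n + 1) ∂ν ≤ ∫⁻ _, q ∂ν :=
        lintegral_mono fun ω => h3 (n + 1) (H ω) (by omega) fun x => h2 _ (hH ω _ x)
    _ = q := by simp

theorem confSet_isRootFinding {ε : ℝ} (hε : 0 < ε) : IsRootFinding ε (confSet (confParam ε)) := by
  refine le_liminf_of_le (by isBoundedDefault) (Eventually.of_forall fun n => ?_)
  exact rootProb_confSet _ (confParam_le hε)

theorem optimalSize_le {ε : ℝ} (hε : 0 < ε) : optimalSize ε ≤ 3 * confParam ε + 5 :=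
  Nat.sInf_le ⟨confSet (confParam ε), card_confSet_le _, confSet_isRootFinding hε⟩

theorem le_optimalSize_mul_log {ε : ℝ} (hε : 0 < ε) (hε' : ε < Real.exp (-200)) :
    1 / 12 * Real.log (1 / ε) ≤ optimalSize ε * Real.log (optimalSize ε) := by
  have hne : {K : ℕ | ∃ H : Procedure, (∀ T, (H T).card ≤ K) ∧ IsRootFinding ε H}.Nonempty :=
    ⟨_, confSet (confParam ε), card_confSet_le _, confSet_isRootFinding hε⟩
  obtain ⟨H, hH, hroot⟩ := Nat.sInf_mem hne
  by_contra! hc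
  -- A deterministic procedure is a randomized one with a one-point seed space.
  have := liminf_lintegral_rootProb_lt hε hε' (Measure.dirac ()) (fun _ => H)
    fun _ n x => (natCast_mul_log_mono (hH (nnTree x))).trans_lt hc
  simp only [lintegral_const, measure_univ, mul_one] at this
  exact absurd hroot (not_le.2 this)

/-- Inverts `K log K ≍ L`. Above, either `K ≤ √L`, which is far below `L / log L` up to a constant,
or `log K ≥ (log L) / 2`. Below, either `log K ≤ log L`, or `K > L` and there is nothing to do. -/
theorem optimalSize_isTheta : (fun ε : ℝ => (optimalSize ε : ℝ)) =Θ[𝓝[>] 0]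
    (fun ε : ℝ => Real.log (1 / ε) / Real.log (Real.log (1 / ε))) := by
  have hev : ∀ᶠ ε : ℝ in 𝓝[>] 0, 0 < ε ∧ ε < Real.exp (-200) :=
    Ioo_mem_nhdsGT (Real.exp_pos _)
  have hlog : ∀ L : ℝ, 200 < L → 1 ≤ Real.log L := fun L hL => by
    rw [← Real.log_exp 1]
    exact Real.log_le_log (Real.exp_pos 1) (by linarith [Real.exp_one_lt_d9])
  constructor
  · refine IsBigO.of_bound (2 * 10 ^ 8) ?_
    filter_upwards [hev] with ε ⟨hε, hε'⟩
    have hL := log_one_div_gt hε hε'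
    have hb := (natCast_mul_log_mono (optimalSize_le hε)).trans (confParam_bounds hε hε').2
    set L := Real.log (1 / ε) with hLdef
    have hl := hlog L hL
    have hL0 : 0 < L := by linarith
    rw [Real.norm_of_nonneg (by positivity), Real.norm_of_nonneg (by positivity),
      ← mul_div_assoc, le_div_iff₀ (by linarith)]
    rcases le_or_gt (optimalSize ε : ℝ) (Real.sqrt L) with h | h
    · have h1 : Real.log L ≤ 2 * Real.sqrt L := by
        have := Real.log_le_sub_one_of_pos (Real.sqrt_pos.2 hL0)
        rw [Real.log_sqrt hL0.le] at this
        linarith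
      calc (optimalSize ε : ℝ) * Real.log L ≤ Real.sqrt L * (2 * Real.sqrt L) := by gcongr
        _ = 2 * L := by rw [mul_left_comm, Real.mul_self_sqrt hL0.le]
        _ ≤ 2 * 10 ^ 8 * L := by linarith
    · have h1 : Real.log L / 2 ≤ Real.log (optimalSize ε) := by
        rw [← Real.log_sqrt hL0.le]
        exact Real.log_le_log (Real.sqrt_pos.2 hL0) h.le
      have h2 : (optimalSize ε : ℝ) * (Real.log L / 2) ≤ optimalSize ε * Real.log (optimalSize ε) :=
        mul_le_mul_of_nonneg_left h1 (by positivity)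
      linarith
  · refine IsBigO.of_bound 12 ?_
    filter_upwards [hev] with ε ⟨hε, hε'⟩
    have hL := log_one_div_gt hε hε'
    have hb := le_optimalSize_mul_log hε hε'
    set L := Real.log (1 / ε) with hLdef
    have hl := hlog L hL
    have hL0 : 0 < L := by linarith
    rw [Real.norm_of_nonneg (by positivity), Real.norm_of_nonneg (by positivity),
      div_le_iff₀ (by linarith)]
    rcases le_or_gt (optimalSize ε : ℝ) L with h | h
    · have hpos : 0 < optimalSize ε := by
        rcases Nat.eq_zero_or_pos (optimalSize ε) with h0 | h0
        · rw [h0] at hb; norm_num at hb; linarith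
        · exact h0
      have h1 : Real.log (optimalSize ε) ≤ Real.log L :=
        Real.log_le_log (by exact_mod_cast hpos) h
      have h2 : (optimalSize ε : ℝ) * Real.log (optimalSize ε) ≤ optimalSize ε * Real.log L :=
        mul_le_mul_of_nonneg_left h1 (by positivity)
      linarith
    · nlinarith

end NNTree

theorem theorem1 :
    ∃ c₁ : ℝ, 0 < c₁ ∧ ∃ c₂ : ℝ, 0 < c₂ ∧
      -- an efficient embedded root finding algorithm with a small confidence set
      (∃ (P : NNTree.Prog) (C : ℝ) (H : ℝ → NNTree.Procedure) (ε₀ : ℝ),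
        0 < ε₀ ∧ ε₀ < 1 ∧
        ∀ ε : ℝ, 0 < ε → ε < ε₀ → ∀ (n : ℕ) [NeZero n],
          (∀ (x : Fin n → UnitAddCircle) (p : Fin n → Fin n),
            Function.Injective x → NNTree.IsNNTree x p →
              NNTree.ReturnsWithin P ε (NNTree.embTree x p) (H ε (NNTree.embTree x p))
                (C * ((n : ℝ) ^ 2 + Real.log (1 / ε) ^ 2)) ∧
              ((H ε (NNTree.embTree x p)).card : ℝ)
                * Real.log ((H ε (NNTree.embTree x p)).card : ℝ) ≤ c₁ * Real.log (1 / ε)) ∧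
          1 - ENNReal.ofReal ε ≤ NNTree.rootProb (H ε) n) ∧
      -- no procedure, even a randomized one with a random seed `ω`, returns a smaller set
      (∃ ε₀ : ℝ, 0 < ε₀ ∧ ε₀ < 1 ∧
        ∀ ε : ℝ, 0 < ε → ε < ε₀ →
          ∀ (Ω : Type) [MeasurableSpace Ω] (ν : MeasureTheory.Measure Ω)
            [MeasureTheory.IsProbabilityMeasure ν] (H : Ω → NNTree.Procedure),
            -- for trees of a given size `n`, unless the whole vertex set is small enough
            (∀ (n : ℕ) [NeZero n], c₂ * Real.log (1 / ε) ≤ (n : ℝ) * Real.log (n : ℝ) →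
              (∀ (ω : Ω) (x : Fin n → UnitAddCircle),
                ((H ω (NNTree.nnTree x)).card : ℝ) * Real.log ((H ω (NNTree.nnTree x)).card : ℝ)
                  < c₂ * Real.log (1 / ε)) →
              ∫⁻ ω, NNTree.rootProb (H ω) n ∂ν < 1 - ENNReal.ofReal ε) ∧
            -- in the limit of large trees
            ((∀ (ω : Ω) (n : ℕ) (x : Fin n → UnitAddCircle),
                ((H ω (NNTree.nnTree x)).card : ℝ) * Real.log ((H ω (NNTree.nnTree x)).card : ℝ)
                  < c₂ * Real.log (1 / ε)) →
              Filter.liminf (fun n : ℕ => ∫⁻ ω, NNTree.rootProb (H ω) (n + 1) ∂ν) Filter.atTop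
                < 1 - ENNReal.ofReal ε)) ∧
      -- the optimal size
      (fun ε : ℝ => (NNTree.optimalSize ε : ℝ)) =Θ[nhdsWithin 0 (Set.Ioi 0)]
        (fun ε : ℝ => Real.log (1 / ε) / Real.log (Real.log (1 / ε))) := by
  have h01 : Real.exp (-200) < 1 := by simp
  refine ⟨10 ^ 8, by norm_num, 1 / 12, by norm_num,
    ⟨NNTree.rootProg, 10 ^ 6, fun ε => NNTree.confSet (NNTree.confParam ε), Real.exp (-200),
      Real.exp_pos _, h01, fun ε hε hε' n _ => ⟨fun x p hx _ => ⟨?_, ?_⟩, ?_⟩⟩,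
    ⟨Real.exp (-200), Real.exp_pos _, h01, fun ε hε hε' Ω _ ν _ H =>
      ⟨fun n _ hn hH => NNTree.lintegral_rootProb_lt hε hε' ν H n hn hH,
        fun hH => NNTree.liminf_lintegral_rootProb_lt hε hε' ν H hH⟩⟩,
    NNTree.optimalSize_isTheta⟩
  · refine NNTree.returnsWithin_rootProg (fun k hk => NNTree.lt_of_lt_confParam hk)
      (NNTree.confParam_le hε) _ ?_
    have hcard : (NNTree.embTree x p).verts.card = n := by
      classical
      exact (Finset.card_image_of_injective _ hx).trans (by simp)
    have hn : (1 : ℝ) ≤ n := by exact_mod_cast Nat.one_le_iff_ne_zero.2 (NeZero.ne n)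
    have hK := (NNTree.confParam_bounds hε hε').1
    have hL := NNTree.log_one_div_gt hε hε'
    rw [hcard]
    -- With `K ≤ 4000 L`, `L > 200` and `n ≥ 1`, the term linear in `K` is absorbed by `L ^ 2` and
    -- `(n + 1) ^ 2` by `4 n ^ 2`.
    nlinarith
  · exact NNTree.confSet_small hε hε' _
  · exact NNTree.rootProb_confSet _ (NNTree.confParam_le hε)
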